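/- **Setting.** Let $\Theta$ be a nonempty set with a metric (or pseudometric) written $\|\theta-\theta'\|$, let $(\mathcal Z,P)$ be a probability space, and for $\theta\in\Theta$ let $m_\theta:\mathcal Z\to\mathbb R$ be measurable and $P$-integrable, with $\|m_{\theta_1}-m_{\theta_2}\|_\infty\le B_0$ for all $\theta_1,\theta_2\in\Theta$. Write $Pf=\int f\,dP$. Let $n\ge 1$, let $D_2=(Z_1,\dots,Z_n)$ be i.i.d. from $P$, and write $\mathbb P_nf=n^{-1}\sum_{i=1}^n f(Z_i)$, $\mathbb G_nf=\sqrt n\,(\mathbb P_n-P)f$. Let $\widehat\theta_1=\widehat\theta_1(D_1)\in\Theta$ be an initial estimator computed from data $D_1$ independent of $D_2$ (with $(D_1,z)\mapsto m_{\widehat\theta_1(D_1)}(z)$ jointly measurable). Put $$\widehat\sigma^2_{\theta,\theta'}=\frac1{n-1}\sum_{i=1}^n\big\{(m_\theta-m_{\theta'})(Z_i)-\mathbb P_n(m_\theta-m_{\theta'})\big\}^2 .$$ For $\alpha=(\alpha_1,\alpha_2)$ with $\alpha_1\in(0,1)$ and an arbitrary real-valued upper confidence bound $U_{n,\alpha_2}(\theta,\widehat\theta_1;D_2)$,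 the empirical-Bernstein confidence set is $$\widehat{\mathrm{CI}}^{\mathrm{E.B.}}_{n,\alpha}=\Big\{\theta\in\Theta:\ \mathbb P_n(m_\theta-m_{\widehat\theta_1})\le\sqrt{\tfrac{2\widehat\sigma^2_{\theta,\widehat\theta_1}\log(2/\alpha_1)}{n}}+\tfrac{7B_0\log(2/\alpha_1)}{3(n-1)}+\big(0\wedge U_{n,\alpha_2}(\theta,\widehat\theta_1;D_2)\big)\Big\},$$ where for $n=1$ the right-hand side is read as $+\infty$, so that the set is $\Theta$. **Assumptions.** $\theta(P)\in\Theta$ is the unique minimizer of $\theta\mapsto Pm_\theta$ over $\Theta$; let $\mathbb C_P(\theta)=P(m_\theta-m_{\theta(P)})$. * (A1) $c_0>0$, $\beta\ge 0$, and $\mathbb C_P(\theta)\ge c_0\|\theta-\theta(P)\|^{1+\beta}$ for all $\theta\in\Theta$. * (A2) $\phi_n:(0,\infty)\to\mathbb R$ satisfies, for every $\delta>0$, $$\mathbb E_P\Big[\sup_{\|\theta-\theta(P)\|<\delta}|\mathbb G_n(m_\theta-m_{\theta(P)})|\Big]\ \vee\ \sup_{\|\theta-\theta(P)\|\le\delta}\big(P(m_\theta-m_{\theta(P)})^2\big)^{1/2}\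 \le\ \phi_n(\delta),$$ and $x\mapsto\phi_n(x)/x^q$ is non-increasing on $(0,\infty)$ for some $q<1+\beta$. (The expectation is an outer expectation on $(\mathcal Z^n,P^n)$ if the supremum is not measurable. It is also assumed that, for all $\delta>0$ and all signs $e_1,\dots,e_n\in\{-1,1\}$, the map $(z_1,\dots,z_n)\mapsto\sup_{\|\theta-\theta(P)\|<\delta}|\sum_i e_i(m_\theta-m_{\theta(P)})^2(z_i)|$ is measurable for the completion of $P^n$.) * (A3) $s_n$ is a random variable with $n^{-1/2}\sqrt{P(m_{\widehat\theta_1}-m_{\theta(P)})^2}+\mathbb C_P(\widehat\theta_1)\le s_n$ almost surely. Let $r_n>0$ be any number such that $$r_n^{-2}\,\phi_n\big(c_0^{-1/(1+\beta)}r_n^{2/(1+\beta)}\big)\le n^{1/2}.$$ **Theorem.** For every $\varepsilon>0$ there is a constant $\mathfrak C>0$ depending only on $\alpha,\beta,q,B_0,\varepsilon$ (in particular not on $n$, $P$, $\Theta$, $c_0$, $\phi_n$, $r_n$, $s_n$) such that, in the setting above, $$\mathbb P_P\Big(\mathrm{Diam}_{\|\cdot\|}\big(\widehat{\mathrm{CI}}^{\mathrm{E.B.}}_{n,\alpha}\big)\le\mathfrak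 C\,c_0^{-1/(1+\beta)}\big(r_n^{2/(1+\beta)}+(B_0/n)^{1/(1+\beta)}+s_n^{1/(1+\beta)}\big)\Big)\ \ge\ 1-\varepsilon ,$$ where, if the event is not measurable, this means that it contains a measurable event of probability at least $1-\varepsilon$. -/

import Mathlib

open MeasureTheory ProbabilityTheory

noncomputable section

namespace MEst

variable {Θ 𝒵 : Type*} {n : ℕ}

/-- Population objective `M(θ, P) = ∫ m_θ dP`. -/
def risk [MeasurableSpace 𝒵] (m : Θ → 𝒵 → ℝ) (P : Measure 𝒵) (θ : Θ) : ℝ :=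
  ∫ z, m θ z ∂P

/-- `θ₀` is the unique minimizer of `θ ↦ M(θ, P)` over the parameter space. -/
def IsUniqueMinimizer [MeasurableSpace 𝒵] (m : Θ → 𝒵 → ℝ) (P : Measure 𝒵) (θ₀ : Θ) : Prop :=
  ∀ θ : Θ, θ ≠ θ₀ → risk m P θ₀ < risk m P θ

/-- Curvature `C_P(θ) = M(θ, P) - M(θ₀, P)`, where `θ₀ = θ(P)`. -/
def curvature [MeasurableSpace 𝒵] (m : Θ → 𝒵 → ℝ) (P : Measure 𝒵) (θ₀ θ : Θ) : ℝ :=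
  risk m P θ - risk m P θ₀

/-- The difference of losses `m_θ - m_θ'`. -/
def lossDiff (m : Θ → 𝒵 → ℝ) (θ θ' : Θ) : 𝒵 → ℝ := fun z => m θ z - m θ' z

/-- `ℙ_n f = n⁻¹ ∑ f(z_i)`. -/
def empMean (z : Fin n → 𝒵) (f : 𝒵 → ℝ) : ℝ := (∑ i, f (z i)) / n

/-- `𝔾_n f = √n (ℙ_n - P) f`. -/
def empG [MeasurableSpace 𝒵] (P : Measure 𝒵) (z : Fin n → 𝒵) (f : 𝒵 → ℝ) : ℝ :=
  √(n : ℝ) * (empMean z f - ∫ x, f x ∂P)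

/-- Sample variance, with the normalization `n - 1` (used for `n ≥ 2`). -/
def sampleVar (z : Fin n → 𝒵) (f : 𝒵 → ℝ) : ℝ :=
  (∑ i, (f (z i) - empMean z f) ^ 2) / ((n : ℝ) - 1)

/-- The empirical-Bernstein confidence set computed from the sample `z`, the initial estimate `θ₁`
and the upper confidence bound `U(θ, θ₁; z)`. For `n = 1` the threshold, which has the factor
`1 / (n - 1)`, is read as `+∞`, so that the set is the whole parameter space. -/
def ebSet (m : Θ → 𝒵 → ℝ) (B₀ α₁ : ℝ) (U : Θ → Θ → (Fin n → 𝒵) → ℝ)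
    (θ₁ : Θ) (z : Fin n → 𝒵) : Set Θ :=
  {θ | 2 ≤ n →
    empMean z (lossDiff m θ θ₁) ≤
      √(2 * sampleVar z (lossDiff m θ θ₁) * Real.log (2 / α₁) / n)
        + 7 * B₀ * Real.log (2 / α₁) / (3 * ((n : ℝ) - 1))
        + min 0 (U θ θ₁ z)}

/-- Outer expectation of a nonnegative function: the infimum of the integrals of its measurable
majorants. It is the usual expectation when the function is measurable. -/
def outerExpectation {S : Type*} [MeasurableSpace S] (μ : Measure S) (h : S → ENNReal) : ENNReal :=
  ⨅ (g : S → ENNReal) (_ : Measurable g) (_ : ∀ s, h s ≤ g s), ∫⁻ s, g s ∂μ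

/-- Curvature (margin) condition: `C_P(θ) ≥ c₀ ‖θ - θ₀‖^(1+β)` for all `θ`. -/
def MarginCondition [PseudoMetricSpace Θ] [MeasurableSpace 𝒵] (m : Θ → 𝒵 → ℝ) (P : Measure 𝒵)
    (θ₀ : Θ) (c₀ β : ℝ) : Prop :=
  ∀ θ : Θ, c₀ * dist θ θ₀ ^ (1 + β) ≤ curvature m P θ₀ θ

/-- `φ` is a modulus for the empirical process and for the `L²(P)` size of the localized class
at sample size `n`, and `φ(x) / x^q` is non-increasing on `(0, ∞)`. -/
structure LocalModulus [PseudoMetricSpace Θ] [MeasurableSpace 𝒵] (m : Θ → 𝒵 → ℝ) (P : Measure 𝒵)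
    (θ₀ : Θ) (n : ℕ) (q : ℝ) (φ : ℝ → ℝ) : Prop where
  maximal : ∀ δ : ℝ, 0 < δ →
    outerExpectation (Measure.pi fun _ : Fin n => P)
      (fun z => ⨆ θ ∈ Metric.ball θ₀ δ,
        ENNReal.ofReal |empG P z (lossDiff m θ θ₀)|) ≤ ENNReal.ofReal (φ δ)
  variance : ∀ δ : ℝ, 0 < δ → ∀ θ ∈ Metric.closedBall θ₀ δ,
    √(∫ z, lossDiff m θ θ₀ z ^ 2 ∂P) ≤ φ δ
  antitone : AntitoneOn (fun x : ℝ => φ x / x ^ q) (Set.Ioi 0)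

/-- The measurability used to symmetrize the squared localized process: for all signs `e`, the map
`(z₁, …, z_n) ↦ sup_{‖θ - θ₀‖ < δ} |∑ e_i (m_θ - m_θ₀)²(z_i)|` is measurable for the completion
of `P^n`. -/
def SquaresMeasurable [PseudoMetricSpace Θ] [MeasurableSpace 𝒵] (m : Θ → 𝒵 → ℝ) (P : Measure 𝒵)
    (θ₀ : Θ) (n : ℕ) : Prop :=
  ∀ δ : ℝ, 0 < δ → ∀ e : Fin n → ℝ, (∀ i, e i = 1 ∨ e i = -1) →
    AEMeasurable (fun z : Fin n → 𝒵 => ⨆ θ ∈ Metric.ball θ₀ δ,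
      ENNReal.ofReal |∑ i, e i * lossDiff m θ θ₀ (z i) ^ 2|) (Measure.pi fun _ : Fin n => P)

/-- `n^(-1/2) (P (m_θ₁ - m_θ₀)²)^(1/2) + C_P(θ₁)`, the quality of `θ₁` as an initial estimate. -/
def initialError [MeasurableSpace 𝒵] (m : Θ → 𝒵 → ℝ) (P : Measure 𝒵) (θ₀ : Θ) (n : ℕ)
    (θ₁ : Θ) : ℝ :=
  (√(n : ℝ))⁻¹ * √(∫ z, lossDiff m θ₁ θ₀ z ^ 2 ∂P) + curvature m P θ₀ θ₁

end MEst

end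

/-! Write θ₀ for the minimizer, `D = c₀ * dist θ θ₀ ^ (1 + β)` and `τ = r ^ 2 + B / n`. For θ in the
set, splitting the empirical mean of `m_θ - m_θ₁` at θ₀ bounds the curvature at θ, hence `D`, by the
curvature at θ₁, the fluctuations at θ and θ₁, the empirical standard deviation and a term of order
`B / n`. The sample variance is dominated by the empirical second moments of `m_θ - m_θ₀` and `m_θ₁
- m_θ₀`.

The terms at θ₁ concern a single function once D₁ is fixed, so Fubini and Markov give
`exists_event_initial`. The terms at θ need uniformity, supplied by `exists_event_empirical`: off an
event of small probability, every θ has a scale `t ≤ M * τ + 2 * D` such that its fluctuation and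
its root empirical second moment over `√n` are at most `η * t`. With η small, these terms add up to
`t / 4 ≤ M * τ / 4 + D / 2`; the `D / 2` is absorbed, leaving `D` of order `τ + s`, and taking the
power `1 / (1 + β)` gives the diameter.

Uniformity comes from peeling over balls of geometrically growing scale. The modulus grows like a
power of the scale smaller than 1 (this is `q < 1 + β`), so the failure probabilities form a
geometric series, made small by M. On one ball (`exists_event_ball`) the process is controlled by
Markov. Its squares are first symmetrized, contracted to the functions themselves (squaring is
Lipschitz on a bounded interval) and desymmetrized, in `lintegral_iSup_sum_sq_le`. -/

/-! ### Rademacher averages -/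

/-- The sign `±1` attached to a Boolean. -/
def boolSign (b : Bool) : ℝ := if b then 1 else -1

lemma boolSign_not (b : Bool) : boolSign (!b) = -boolSign b := by
  cases b <;> simp [boolSign]

lemma boolSign_eq_or (b : Bool) : boolSign b = 1 ∨ boolSign b = -1 := by
  cases b <;> simp [boolSign]

lemma abs_boolSign (b : Bool) : |boolSign b| = 1 := by
  cases b <;> simp [boolSign]

lemma boolSign_mul_self (b : Bool) : boolSign b * boolSign b = 1 := by
  cases b <;> simp [boolSign]

section Rademacher

variable {ι κ : Type*}

section

variable [Fintype ι]

lemma bddAbove_range_sign_sum {w : κ → ι → ℝ} {b : ℝ} (hw : ∀ s i, |w s i| ≤ b) (e : ι → Bool) :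
    BddAbove (Set.range fun s => ∑ i, boolSign (e i) * w s i) := by
  refine ⟨∑ _i : ι, b, ?_⟩
  rintro _ ⟨s, rfl⟩
  refine Finset.sum_le_sum fun i _ => (le_abs_self _).trans ?_
  rw [abs_mul, abs_boolSign, one_mul]
  exact hw s i

lemma bddAbove_range_abs_sign_sum {w : κ → ι → ℝ} {b : ℝ} (hw : ∀ s i, |w s i| ≤ b)
    (e : ι → Bool) : BddAbove (Set.range fun s => |∑ i, boolSign (e i) * w s i|) := by
  refine ⟨∑ _i : ι, b, ?_⟩
  rintro _ ⟨s, rfl⟩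
  refine (Finset.abs_sum_le_sum_abs _ _).trans (Finset.sum_le_sum fun i _ => ?_)
  rw [abs_mul, abs_boolSign, one_mul]
  exact hw s i

end

/-- One step of the contraction principle. -/
lemma ciSup_add_add_ciSup_sub_le [Nonempty κ] {A x y : κ → ℝ}
    (hx₁ : BddAbove (Set.range fun s => A s + x s)) (hx₂ : BddAbove (Set.range fun s => A s - x s))
    (hxy : ∀ s t, |y s - y t| ≤ |x s - x t|) :
    (⨆ s, (A s + y s)) + ⨆ s, (A s - y s) ≤ (⨆ s, (A s + x s)) + ⨆ s, (A s - x s) := by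
  refine ciSup_add_ciSup_le fun s t => ?_
  have h := (le_abs_self _).trans (hxy s t)
  have h1 := le_ciSup hx₁ s
  have h2 := le_ciSup hx₂ s
  -- When `x s < x t`, it is the swapped pair `(t, s)` that dominates on the right-hand side.
  have h3 := le_ciSup hx₁ t
  have h4 := le_ciSup hx₂ t
  rcases abs_cases (x s - x t) with ⟨h5, -⟩ | ⟨h5, -⟩ <;> linarith

variable [DecidableEq ι]

/-- Flipping one coordinate of a Boolean vector. -/
def flipAt (k : ι) (e : ι → Bool) : ι → Bool := Function.update e k (!e k)

lemma flipAt_involutive (k : ι) : Function.Involutive (flipAt k) := by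
  intro e
  ext i
  by_cases h : i = k
  · subst h; simp [flipAt]
  · simp [flipAt, h]

lemma flipAt_self (k : ι) (e : ι → Bool) : flipAt k e k = !e k := by simp [flipAt]

lemma flipAt_of_ne {k i : ι} (h : i ≠ k) (e : ι → Bool) : flipAt k e i = e i := by
  simp [flipAt, h]

variable [Fintype ι]

lemma sum_flipAt (k : ι) (F : (ι → Bool) → ℝ) : ∑ e, F (flipAt k e) = ∑ e, F e :=
  Equiv.sum_comp (flipAt_involutive k).toPerm F

lemma sum_not (F : (ι → Bool) → ℝ) : ∑ e : ι → Bool, F (fun i => !e i) = ∑ e, F e := by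
  have h : Function.Involutive (fun (e : ι → Bool) (i : ι) => !e i) := by
    intro e; ext i; simp
  exact Equiv.sum_comp h.toPerm F

lemma sign_sum_eq_add (k : ι) (e : ι → Bool) (w : ι → ℝ) :
    ∑ i, boolSign (e i) * w i =
      ∑ i ∈ Finset.univ.erase k, boolSign (e i) * w i + boolSign (e k) * w k :=
  (Finset.sum_erase_add _ _ (Finset.mem_univ k)).symm

/-- Replacing one coordinate by a contraction of it does not increase the Rademacher average. -/
lemma sum_ciSup_sign_sum_le_of_coord [Nonempty κ] {v w : κ → ι → ℝ} {b : ℝ} (k : ι)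
    (hw : ∀ s i, |w s i| ≤ b) (hvw : ∀ s i, i ≠ k → v s i = w s i)
    (hk : ∀ s t, |v s k - v t k| ≤ |w s k - w t k|) :
    ∑ e : ι → Bool, ⨆ s, ∑ i, boolSign (e i) * v s i ≤
      ∑ e : ι → Bool, ⨆ s, ∑ i, boolSign (e i) * w s i := by
  have key : ∀ u : κ → ι → ℝ, ∀ e : ι → Bool, ∀ s,
      ∑ i, boolSign (flipAt k e i) * u s i =
        ∑ i ∈ Finset.univ.erase k, boolSign (e i) * u s i - boolSign (e k) * u s k := by
    intro u e s
    rw [sign_sum_eq_add k, flipAt_self, boolSign_not, neg_mul, ← sub_eq_add_neg]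
    congr 1
    refine Finset.sum_congr rfl fun i hi => ?_
    rw [flipAt_of_ne (Finset.ne_of_mem_erase hi)]
  have hv : ∀ e : ι → Bool, ∀ s, ∑ i ∈ Finset.univ.erase k, boolSign (e i) * v s i =
      ∑ i ∈ Finset.univ.erase k, boolSign (e i) * w s i := fun e s =>
    Finset.sum_congr rfl fun i hi => by rw [hvw s i (Finset.ne_of_mem_erase hi)]
  -- Pairing `e` with its flip at `k` freezes all other coordinates into a common term, which leaves
  -- the two-supremum inequality. Summing over `e` counts each side twice.
  have step : ∀ e : ι → Bool,
      (⨆ s, ∑ i, boolSign (e i) * v s i) + (⨆ s, ∑ i, boolSign (flipAt k e i) * v s i) ≤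
      (⨆ s, ∑ i, boolSign (e i) * w s i) + ⨆ s, ∑ i, boolSign (flipAt k e i) * w s i := by
    intro e
    have b1 := bddAbove_range_sign_sum hw e
    have b2 := bddAbove_range_sign_sum hw (flipAt k e)
    simp only [key] at b2 ⊢
    simp only [sign_sum_eq_add k e, hv] at b1 ⊢
    refine ciSup_add_add_ciSup_sub_le b1 b2 fun s t => ?_
    rw [← mul_sub, ← mul_sub, abs_mul, abs_mul, abs_boolSign, one_mul, one_mul]
    exact hk s t
  have total := Finset.sum_le_sum fun e (_ : e ∈ (Finset.univ : Finset (ι → Bool))) => step e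
  rw [Finset.sum_add_distrib, Finset.sum_add_distrib,
    sum_flipAt k (fun e => ⨆ s, ∑ i, boolSign (e i) * v s i),
    sum_flipAt k (fun e => ⨆ s, ∑ i, boolSign (e i) * w s i)] at total
  linarith

/-- **Contraction principle** for Rademacher averages. -/
theorem sum_ciSup_sign_sum_le [Nonempty κ] {v w : κ → ι → ℝ} {b : ℝ}
    (hv : ∀ s i, |v s i| ≤ b) (hw : ∀ s i, |w s i| ≤ b)
    (hvw : ∀ i s t, |v s i - v t i| ≤ |w s i - w t i|) :
    ∑ e : ι → Bool, ⨆ s, ∑ i, boolSign (e i) * v s i ≤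
      ∑ e : ι → Bool, ⨆ s, ∑ i, boolSign (e i) * w s i := by
  -- Hybrid argument: the coordinates in `S` have already been contracted, one at a time.
  have main : ∀ S : Finset ι,
      ∑ e : ι → Bool, ⨆ s, ∑ i, boolSign (e i) * (if i ∈ S then v s i else w s i) ≤
        ∑ e : ι → Bool, ⨆ s, ∑ i, boolSign (e i) * w s i := by
    intro S
    induction S using Finset.induction_on with
    | empty => simp
    | insert k S hkS ih =>
      refine le_trans (sum_ciSup_sign_sum_le_of_coord (b := b) k
        (v := fun s i => if i ∈ insert k S then v s i else w s i)
        (w := fun s i => if i ∈ S then v s i else w s i) ?_ ?_ ?_) ih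
      · intro s i
        split_ifs
        exacts [hv s i, hw s i]
      · intro s i hi
        simp [Finset.mem_insert, hi]
      · intro s t
        simpa [hkS] using hvw k s t
  simpa using main Finset.univ

/-- The contraction principle with absolute values, for index sets that contain the zero vector. -/
theorem sum_ciSup_abs_sign_sum_le {v w : κ → ι → ℝ} {b : ℝ}
    (hv : ∀ s i, |v s i| ≤ b) (hw : ∀ s i, |w s i| ≤ b)
    (hvw : ∀ i s t, |v s i - v t i| ≤ |w s i - w t i|) (s₀ : κ) (h₀ : ∀ i, v s₀ i = 0) :
    ∑ e : ι → Bool, ⨆ s, |∑ i, boolSign (e i) * v s i| ≤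
      2 * ∑ e : ι → Bool, ⨆ s, |∑ i, boolSign (e i) * w s i| := by
  have : Nonempty κ := ⟨s₀⟩
  have hneg : ∀ (e : ι → Bool) s, ∑ i, boolSign (!e i) * v s i = -∑ i, boolSign (e i) * v s i := by
    intro e s
    simp [boolSign_not]
  -- The zero vector makes both suprema nonnegative, so their sum dominates each. Negating all signs
  -- turns the second into the first after summation over `e`.
  have h1 : ∀ e : ι → Bool, (⨆ s, |∑ i, boolSign (e i) * v s i|) ≤
      (⨆ s, ∑ i, boolSign (e i) * v s i) + ⨆ s, ∑ i, boolSign (!e i) * v s i := by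
    intro e
    have b1 := bddAbove_range_sign_sum hv e
    have b2 := bddAbove_range_sign_sum hv (fun i => !e i)
    have p1 := le_ciSup b1 s₀
    have p2 := le_ciSup b2 s₀
    simp only [h₀, mul_zero, Finset.sum_const_zero] at p1 p2
    refine ciSup_le fun s => ?_
    have q1 := le_ciSup b1 s
    have q2 := le_ciSup b2 s
    rw [hneg] at q2
    rcases abs_cases (∑ i, boolSign (e i) * v s i) with ⟨h, -⟩ | ⟨h, -⟩ <;> linarith
  have h2 := Finset.sum_le_sum fun e (_ : e ∈ (Finset.univ : Finset (ι → Bool))) => h1 e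
  rw [Finset.sum_add_distrib, sum_not (fun e => ⨆ s, ∑ i, boolSign (e i) * v s i)] at h2
  have h3 := sum_ciSup_sign_sum_le hv hw hvw
  have h4 : ∑ e : ι → Bool, ⨆ s, ∑ i, boolSign (e i) * w s i ≤
      ∑ e : ι → Bool, ⨆ s, |∑ i, boolSign (e i) * w s i| :=
    Finset.sum_le_sum fun e _ =>
      ciSup_mono (bddAbove_range_abs_sign_sum hw e) fun s => le_abs_self _
  linarith

/-- Distinct signs are orthogonal: flipping one of them changes the sign of the product. -/
lemma sum_sq_sign_sum : ∑ e : ι → Bool, (∑ i, boolSign (e i)) ^ 2 =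
    Fintype.card (ι → Bool) * (Fintype.card ι : ℝ) := by
  have h : ∀ i j : ι, ∑ e : ι → Bool, boolSign (e i) * boolSign (e j) =
      if i = j then (Fintype.card (ι → Bool) : ℝ) else 0 := by
    intro i j
    split_ifs with hij
    · subst hij
      simp [boolSign_mul_self]
    · have := sum_flipAt i fun e : ι → Bool => boolSign (e i) * boolSign (e j)
      simp only [flipAt_self, flipAt_of_ne (Ne.symm hij), boolSign_not, neg_mul,
        Finset.sum_neg_distrib] at this
      linarith
  simp_rw [sq, Finset.sum_mul_sum]
  rw [Finset.sum_comm]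
  simp_rw [Finset.sum_comm (s := (Finset.univ : Finset (ι → Bool))), h]
  simp [mul_comm]

lemma sum_abs_sign_sum_le : ∑ e : ι → Bool, |∑ i, boolSign (e i)| ≤
    Fintype.card (ι → Bool) * √(Fintype.card ι : ℝ) := by
  refine abs_le_of_sq_le_sq' ?_ (by positivity) |>.2
  refine (sq_sum_le_card_mul_sum_sq).trans (le_of_eq ?_)
  simp_rw [sq_abs]
  rw [sum_sq_sign_sum, mul_pow, Real.sq_sqrt (by positivity), Finset.card_univ]
  ring

/-- Contraction of the squares of a class of functions bounded by `B`. -/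
theorem sum_ciSup_abs_sign_sum_sq_le {x : κ → ι → ℝ} {B : ℝ}
    (hx : ∀ s i, |x s i| ≤ B) (s₀ : κ) (h₀ : ∀ i, x s₀ i = 0) :
    ∑ e : ι → Bool, ⨆ s, |∑ i, boolSign (e i) * x s i ^ 2| ≤
      4 * B * ∑ e : ι → Bool, ⨆ s, |∑ i, boolSign (e i) * x s i| := by
  rcases isEmpty_or_nonempty ι with hι | ⟨⟨i₀⟩⟩
  · simp
  have hB : 0 ≤ B := (abs_nonneg _).trans (hx s₀ i₀)
  -- Squaring is `2 * B`-Lipschitz on `[-B, B]`; the absolute values cost another factor 2.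
  have h := sum_ciSup_abs_sign_sum_le (v := fun s i => x s i ^ 2) (w := fun s i => 2 * B * x s i)
    (b := 2 * B ^ 2) ?_ ?_ ?_ s₀ (by simp [h₀])
  · refine h.trans (le_of_eq ?_)
    rw [Finset.mul_sum, Finset.mul_sum]
    refine Finset.sum_congr rfl fun e _ => ?_
    have : ∀ s, |∑ i, boolSign (e i) * (2 * B * x s i)| =
        2 * B * |∑ i, boolSign (e i) * x s i| := by
      intro s
      rw [← abs_of_nonneg (by positivity : 0 ≤ 2 * B), ← abs_mul, Finset.mul_sum,
        abs_of_nonneg (by positivity : 0 ≤ 2 * B)]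
      congr 1
      exact Finset.sum_congr rfl fun i _ => by ring
    simp_rw [this]
    rw [← Real.mul_iSup_of_nonneg (by positivity)]
    ring
  · intro s i
    rw [abs_pow]
    nlinarith [hx s i, abs_nonneg (x s i), pow_le_pow_left₀ (abs_nonneg (x s i)) (hx s i) 2]
  · intro s i
    rw [abs_mul, abs_of_nonneg (by positivity : 0 ≤ 2 * B)]
    nlinarith [hx s i, abs_nonneg (x s i)]
  · intro i s t
    rw [← mul_sub, abs_mul, abs_of_nonneg (by positivity : 0 ≤ 2 * B), sq_sub_sq, abs_mul]
    refine mul_le_mul_of_nonneg_right ?_ (abs_nonneg _)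
    exact (abs_add_le _ _).trans (by linarith [hx s i, hx t i])

end Rademacher

/-! ### Symmetrization -/

/-- The value is raised to `⊤` on a measurable null set. Domination at every point is needed because
the majorant is later evaluated on samples with part of the coordinates fixed. -/
lemma exists_measurable_majorant {α : Type*} [MeasurableSpace α] {μ : Measure α}
    {h : α → ENNReal} (hh : AEMeasurable h μ) :
    ∃ g, Measurable g ∧ (∀ x, h x ≤ g x) ∧ ∫⁻ x, g x ∂μ = ∫⁻ x, h x ∂μ := by
  classical
  set N := toMeasurable μ {x | h x ≠ hh.mk h x} with hN
  have hμN : μ N = 0 := by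
    rw [hN, measure_toMeasurable]
    exact hh.ae_eq_mk
  have hNm : MeasurableSet N := measurableSet_toMeasurable _ _
  refine ⟨N.piecewise (fun _ => ⊤) (hh.mk h), measurable_const.piecewise hNm hh.measurable_mk,
    fun x => ?_, ?_⟩
  · by_cases hx : x ∈ N
    · simp [hx]
    · have : h x = hh.mk h x := by
        by_contra hne
        exact hx (subset_toMeasurable _ _ hne)
      simp [hx, this]
  · refine lintegral_congr_ae ?_
    have : ∀ᵐ x ∂μ, x ∉ N := measure_eq_zero_iff_ae_notMem.1 hμN
    filter_upwards [this, hh.ae_eq_mk] with x hx hx'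
    simp [hx, hx']

lemma ENNReal.ofReal_ciSup_le {κ : Type*} [Nonempty κ] {x : κ → ℝ} {a : ENNReal}
    (h : ∀ s, ENNReal.ofReal (x s) ≤ a) : ENNReal.ofReal (⨆ s, x s) ≤ a := by
  rcases eq_or_ne a ⊤ with rfl | ha
  · exact le_top
  · refine ENNReal.ofReal_le_of_le_toReal (ciSup_le fun s => ?_)
    exact (ENNReal.ofReal_le_iff_le_toReal ha).1 (h s)

lemma ENNReal.ofReal_abs_integral_le {α : Type*} [MeasurableSpace α] {μ : Measure α} (f : α → ℝ) :
    ENNReal.ofReal |∫ x, f x ∂μ| ≤ ∫⁻ x, ENNReal.ofReal |f x| ∂μ := by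
  simpa [Real.enorm_eq_ofReal_abs] using enorm_integral_le_lintegral_enorm (μ := μ) f

section Symmetrization

variable {ι κ 𝒵 : Type*} [Fintype ι] [MeasurableSpace 𝒵]

/-- The sample that takes its `i`-th point from `p.1` if `e i`, and from `p.2` otherwise. -/
def mixSample (e : ι → Bool) (p : (ι → 𝒵) × (ι → 𝒵)) : ι → 𝒵 :=
  fun i => if e i then p.1 i else p.2 i

lemma measurable_mixSample (e : ι → Bool) :
    Measurable (mixSample e : (ι → 𝒵) × (ι → 𝒵) → ι → 𝒵) := by
  refine measurable_pi_lambda _ fun i => ?_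
  unfold mixSample
  cases e i
  · simpa using measurable_snd.eval
  · simpa using measurable_fst.eval

/-- In each coordinate a box constrains exactly one of the two samples, the other contributing mass
1. This is the exchangeability of a sample with its ghost copy. -/
lemma measurePreserving_mixSample (P : Measure 𝒵) [IsProbabilityMeasure P] (e : ι → Bool) :
    MeasurePreserving (mixSample e)
      ((Measure.pi fun _ : ι => P).prod (Measure.pi fun _ : ι => P))
      (Measure.pi fun _ : ι => P) := by
  refine ⟨measurable_mixSample e, (Measure.pi_eq fun s hs => ?_).symm⟩
  rw [Measure.map_apply (measurable_mixSample e) (MeasurableSet.univ_pi hs)]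
  have : mixSample e ⁻¹' (Set.univ.pi s) =
      (Set.univ.pi fun i => if e i then s i else Set.univ) ×ˢ
        (Set.univ.pi fun i => if e i then Set.univ else s i) := by
    ext p
    simp only [Set.mem_preimage, Set.mem_univ_pi, Set.mem_prod, mixSample, ← forall_and]
    refine forall_congr' fun i => ?_
    cases e i <;> simp
  rw [this, Measure.prod_prod, Measure.pi_pi, Measure.pi_pi, ← Finset.prod_mul_distrib]
  refine Finset.prod_congr rfl fun i _ => ?_
  cases e i <;> simp

lemma lintegral_lintegral_mixSample (P : Measure 𝒵) [IsProbabilityMeasure P] (e : ι → Bool)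
    {g : (ι → 𝒵) → ENNReal} (hg : Measurable g) :
    ∫⁻ z, ∫⁻ z', g (mixSample e (z, z')) ∂(Measure.pi fun _ : ι => P)
      ∂(Measure.pi fun _ : ι => P) = ∫⁻ z, g z ∂(Measure.pi fun _ : ι => P) := by
  rw [← (measurePreserving_mixSample P e).lintegral_comp hg,
    lintegral_prod (fun p => g (mixSample e p)) (hg.comp (measurable_mixSample e)).aemeasurable]

lemma measurable_lintegral_mixSample (P : Measure 𝒵) [IsProbabilityMeasure P] (e : ι → Bool)
    {g : (ι → 𝒵) → ENNReal} (hg : Measurable g) :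
    Measurable fun z => ∫⁻ z', g (mixSample e (z, z')) ∂(Measure.pi fun _ : ι => P) :=
  (hg.comp (measurable_mixSample e)).lintegral_prod_right'

lemma integrable_eval_pi {P : Measure 𝒵} [IsProbabilityMeasure P] {F : 𝒵 → ℝ}
    (hF : Integrable F P) (i : ι) :
    Integrable (fun z : ι → 𝒵 => F (z i)) (Measure.pi fun _ : ι => P) :=
  (measurePreserving_eval (fun _ : ι => P) i).integrable_comp_of_integrable hF

lemma integral_eval_pi {P : Measure 𝒵} [IsProbabilityMeasure P] {F : 𝒵 → ℝ}
    (hF : Integrable F P) (i : ι) :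
    ∫ z : ι → 𝒵, F (z i) ∂(Measure.pi fun _ : ι => P) = ∫ z, F z ∂P := by
  have h := measurePreserving_eval (fun _ : ι => P) i
  have hF' : AEStronglyMeasurable F (Measure.map (Function.eval i) (Measure.pi fun _ : ι => P)) := by
    rw [h.map_eq]; exact hF.aestronglyMeasurable
  have h' := integral_map h.measurable.aemeasurable hF'
  rw [h.map_eq] at h'
  exact h'.symm

/-- Symmetrization with a fixed vector of signs. -/
theorem lintegral_iSup_sum_le {P : Measure 𝒵} [IsProbabilityMeasure P] {F : κ → 𝒵 → ℝ} {v : ℝ}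
    (hF : ∀ s, Integrable (F s) P) (hv : ∀ s, ∫ z, F s z ∂P ≤ v) (e : ι → Bool)
    (he : AEMeasurable (fun z : ι → 𝒵 => ⨆ s, ENNReal.ofReal |∑ i, boolSign (e i) * F s (z i)|)
      (Measure.pi fun _ : ι => P)) :
    ∫⁻ z : ι → 𝒵, ⨆ s, ENNReal.ofReal (∑ i, F s (z i)) ∂(Measure.pi fun _ : ι => P) ≤
      ENNReal.ofReal (Fintype.card ι * v) +
        2 * ∫⁻ z : ι → 𝒵, ⨆ s, ENNReal.ofReal |∑ i, boolSign (e i) * F s (z i)|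
          ∂(Measure.pi fun _ : ι => P) := by
  set Q := Measure.pi fun _ : ι => P
  obtain ⟨h, hm, hle, hint⟩ := exists_measurable_majorant he
  -- Where `e i` is false, the sign -1 compensates the exchange of `z i` and `z' i`. Both mixed
  -- samples have the law of `z`.
  have hsplit : ∀ s (z z' : ι → 𝒵), ∑ i, (F s (z i) - F s (z' i)) =
      ∑ i, boolSign (e i) * F s (mixSample e (z, z') i) -
        ∑ i, boolSign (e i) * F s (mixSample (fun i => !e i) (z, z') i) := by
    intro s z z'
    rw [← Finset.sum_sub_distrib]
    refine Finset.sum_congr rfl fun i _ => ?_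
    simp only [mixSample]
    cases e i <;> simp [boolSign]
    ring
  have hpt : ∀ z : ι → 𝒵, (⨆ s, ENNReal.ofReal (∑ i, F s (z i))) ≤
      ENNReal.ofReal (Fintype.card ι * v) +
        ((∫⁻ z', h (mixSample e (z, z')) ∂Q) +
          ∫⁻ z', h (mixSample (fun i => !e i) (z, z')) ∂Q) := by
    intro z
    refine iSup_le fun s => ?_
    have hi : ∫ z', ∑ i, (F s (z i) - F s (z' i)) ∂Q =
        ∑ i, F s (z i) - Fintype.card ι * ∫ z, F s z ∂P := by
      have hint : ∀ i, Integrable (fun z' : ι → 𝒵 => F s (z i) - F s (z' i)) Q := fun i =>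
        (integrable_const _).sub (integrable_eval_pi (hF s) i)
      rw [integral_finsetSum _ fun i _ => hint i]
      have : ∀ i, ∫ z', (F s (z i) - F s (z' i)) ∂Q = F s (z i) - ∫ z, F s z ∂P := by
        intro i
        rw [integral_sub (integrable_const _) (integrable_eval_pi (hF s) i),
          integral_eval_pi (hF s)]
        simp
      simp [this]
    have h1 : ∑ i, F s (z i) ≤ Fintype.card ι * v +
        |∫ z', ∑ i, (F s (z i) - F s (z' i)) ∂Q| := by
      have := le_abs_self (∫ z', ∑ i, (F s (z i) - F s (z' i)) ∂Q)
      have h2 : (Fintype.card ι : ℝ) * ∫ z, F s z ∂P ≤ Fintype.card ι * v :=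
        mul_le_mul_of_nonneg_left (hv s) (by positivity)
      linarith
    refine (ENNReal.ofReal_le_ofReal h1).trans (ENNReal.ofReal_add_le.trans ?_)
    gcongr
    refine (ENNReal.ofReal_abs_integral_le _).trans ?_
    have hm' : Measurable fun z' => h (mixSample e (z, z')) :=
      hm.comp ((measurable_mixSample e).comp measurable_prodMk_left)
    rw [← lintegral_add_left hm']
    refine lintegral_mono fun z' => ?_
    rw [hsplit]
    refine (ENNReal.ofReal_le_ofReal (abs_sub _ _)).trans (ENNReal.ofReal_add_le.trans ?_)
    exact add_le_add
      ((le_iSup (fun s => ENNReal.ofReal |∑ i, boolSign (e i) * F s (mixSample e (z, z') i)|)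
        s).trans (hle _))
      ((le_iSup (fun s => ENNReal.ofReal
        |∑ i, boolSign (e i) * F s (mixSample (fun i => !e i) (z, z') i)|) s).trans (hle _))
  refine (lintegral_mono hpt).trans (le_of_eq ?_)
  rw [lintegral_add_left measurable_const,
    lintegral_add_left (measurable_lintegral_mixSample P e hm),
    lintegral_lintegral_mixSample P _ hm, lintegral_lintegral_mixSample P _ hm, hint]
  simp [two_mul, Q]

/-- Desymmetrization: signed sums are controlled by a majorant of the centered sums. -/
theorem ofReal_abs_sign_sum_le {P : Measure 𝒵} [IsProbabilityMeasure P] {f : 𝒵 → ℝ} {c : ℝ}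
    (hf : Integrable f P) (hc : |∫ z, f z ∂P| ≤ c) {g : (ι → 𝒵) → ENNReal}
    (hg : ∀ z : ι → 𝒵, ENNReal.ofReal |∑ i, (f (z i) - ∫ x, f x ∂P)| ≤ g z) (e : ι → Bool)
    (z : ι → 𝒵) :
    ENNReal.ofReal |∑ i, boolSign (e i) * f (z i)| ≤
      (∫⁻ z', g (mixSample e (z, z')) ∂(Measure.pi fun _ : ι => P)) +
      (∫⁻ z', g (mixSample (fun i => !e i) (z, z')) ∂(Measure.pi fun _ : ι => P)) +
      ENNReal.ofReal (|∑ i, boolSign (e i)| * c) := by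
  set Q := Measure.pi fun _ : ι => P
  set a := ∫ x, f x ∂P
  -- Jensen: the ghost coordinates are centered, so the partial sum is the full centered sum of the
  -- mixed sample integrated over `z'`.
  have hpart : ∀ e : ι → Bool, ENNReal.ofReal |∑ i, if e i then f (z i) - a else 0| ≤
      ∫⁻ z', g (mixSample e (z, z')) ∂Q := by
    intro e
    have hi : ∫ z', ∑ i, (f (mixSample e (z, z') i) - a) ∂Q =
        ∑ i, if e i then f (z i) - a else 0 := by
      have hint : ∀ i, Integrable (fun z' => f (mixSample e (z, z') i) - a) Q := by
        intro i
        simp only [mixSample]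
        cases e i
        · exact (integrable_eval_pi hf i).sub (integrable_const a)
        · simp
      rw [integral_finsetSum _ fun i _ => hint i]
      refine Finset.sum_congr rfl fun i _ => ?_
      simp only [mixSample]
      cases e i
      · simp only [Bool.false_eq_true, if_false]
        rw [integral_sub (integrable_eval_pi hf i) (integrable_const a), integral_eval_pi hf]
        simp [a]
      · simp
    rw [← hi]
    exact (ENNReal.ofReal_abs_integral_le _).trans (lintegral_mono fun z' => hg _)
  have hsum : ∑ i, boolSign (e i) * f (z i) =
      (∑ i, if e i then f (z i) - a else 0) - (∑ i, if !e i then f (z i) - a else 0) +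
        (∑ i, boolSign (e i)) * a := by
    rw [Finset.sum_mul, ← Finset.sum_sub_distrib, ← Finset.sum_add_distrib]
    refine Finset.sum_congr rfl fun i _ => ?_
    cases e i <;> simp [boolSign] <;> ring
  have habs : |∑ i, boolSign (e i) * f (z i)| ≤
      |∑ i, if e i then f (z i) - a else 0| + |∑ i, if !e i then f (z i) - a else 0| +
        |∑ i, boolSign (e i)| * c := by
    rw [hsum]
    refine (abs_add_le _ _).trans (add_le_add (abs_sub _ _) ?_)
    rw [abs_mul]
    exact mul_le_mul_of_nonneg_left hc (abs_nonneg _)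
  refine (ENNReal.ofReal_le_ofReal habs).trans (ENNReal.ofReal_add_le.trans ?_)
  refine add_le_add (ENNReal.ofReal_add_le.trans ?_) le_rfl
  exact add_le_add (hpart e) (hpart _)

/-- Bound for the expected supremum of the sums of squares of a bounded class that contains `0`,
in terms of a majorant of the centered sums. -/
theorem lintegral_iSup_sum_sq_le {P : Measure 𝒵} [IsProbabilityMeasure P] {f : κ → 𝒵 → ℝ}
    {B v c : ℝ} (hf : ∀ s, Measurable (f s)) (hB : ∀ s z, |f s z| ≤ B) (s₀ : κ)
    (h₀ : ∀ z, f s₀ z = 0) (hv : ∀ s, ∫ z, f s z ^ 2 ∂P ≤ v) (hc : ∀ s, |∫ z, f s z ∂P| ≤ c)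
    (hH : ∀ e : ι → Bool, AEMeasurable
      (fun z : ι → 𝒵 => ⨆ s, ENNReal.ofReal |∑ i, boolSign (e i) * f s (z i) ^ 2|)
      (Measure.pi fun _ : ι => P))
    {g : (ι → 𝒵) → ENNReal} (hgm : Measurable g)
    (hg : ∀ s, ∀ z : ι → 𝒵, ENNReal.ofReal |∑ i, (f s (z i) - ∫ x, f s x ∂P)| ≤ g z) :
    ∫⁻ z : ι → 𝒵, ⨆ s, ENNReal.ofReal (∑ i, f s (z i) ^ 2) ∂(Measure.pi fun _ : ι => P) ≤
      ENNReal.ofReal (Fintype.card ι * v) + ENNReal.ofReal (8 * B) *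
        (2 * ∫⁻ z, g z ∂(Measure.pi fun _ : ι => P) +
          ENNReal.ofReal (√(Fintype.card ι : ℝ) * c)) := by
  classical
  have : Nonempty κ := ⟨s₀⟩
  obtain ⟨x₀⟩ : Nonempty 𝒵 := nonempty_of_isProbabilityMeasure P
  have hB0 : 0 ≤ B := (abs_nonneg _).trans (hB s₀ x₀)
  have hc0 : 0 ≤ c := (abs_nonneg _).trans (hc s₀)
  set Q := Measure.pi fun _ : ι => P
  set I := ∫⁻ z : ι → 𝒵, ⨆ s, ENNReal.ofReal (∑ i, f s (z i) ^ 2) ∂Q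
  set H : (ι → Bool) → (ι → 𝒵) → ENNReal := fun e z =>
    ⨆ s, ENNReal.ofReal |∑ i, boolSign (e i) * f s (z i) ^ 2|
  set G : (ι → Bool) → (ι → 𝒵) → ENNReal := fun e z =>
    (∫⁻ z', g (mixSample e (z, z')) ∂Q) + (∫⁻ z', g (mixSample (fun i => !e i) (z, z')) ∂Q) +
      ENNReal.ofReal (|∑ i, boolSign (e i)| * c)
  set N : ENNReal := (Fintype.card (ι → Bool) : ENNReal)
  have hN0 : N ≠ 0 := by simp [N]
  have hNt : N ≠ ⊤ := by simp [N]
  have hfi : ∀ s, Integrable (f s) P := fun s =>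
    Integrable.of_bound (hf s).aestronglyMeasurable B (ae_of_all _ fun z => hB s z)
  have hf2i : ∀ s, Integrable (fun z => f s z ^ 2) P := fun s =>
    Integrable.of_bound ((hf s).pow_const 2).aestronglyMeasurable (B ^ 2) (ae_of_all _ fun z => by
      rw [Real.norm_eq_abs, abs_pow]; exact pow_le_pow_left₀ (abs_nonneg _) (hB s z) 2)
  -- Symmetrization holds for each sign vector, contraction only on average; so everything is summed
  -- over `e`, and the number `N` of sign vectors is cancelled at the end.
  have h1 : ∀ e, I ≤ ENNReal.ofReal (Fintype.card ι * v) + 2 * ∫⁻ z, H e z ∂Q := fun e =>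
    lintegral_iSup_sum_le hf2i hv e (hH e)
  have hcontr : ∀ z, ∑ e, H e z ≤ ENNReal.ofReal (4 * B) * ∑ e, G e z := by
    intro z
    have hR := sum_ciSup_abs_sign_sum_sq_le (x := fun s i => f s (z i)) (fun s i => hB s (z i)) s₀
      (fun i => h₀ _)
    have hb2 : ∀ s i, |f s (z i) ^ 2| ≤ B ^ 2 := fun s i => by
      rw [abs_pow]; exact pow_le_pow_left₀ (abs_nonneg _) (hB s _) 2
    calc ∑ e, H e z ≤ ∑ e : ι → Bool,
          ENNReal.ofReal (⨆ s, |∑ i, boolSign (e i) * f s (z i) ^ 2|) :=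
        Finset.sum_le_sum fun e _ => iSup_le fun s => ENNReal.ofReal_le_ofReal
          (le_ciSup (bddAbove_range_abs_sign_sum hb2 e) s)
      _ = ENNReal.ofReal (∑ e : ι → Bool, ⨆ s, |∑ i, boolSign (e i) * f s (z i) ^ 2|) :=
        (ENNReal.ofReal_sum_of_nonneg fun e _ => Real.iSup_nonneg fun s => abs_nonneg _).symm
      _ ≤ ENNReal.ofReal (4 * B * ∑ e : ι → Bool, ⨆ s, |∑ i, boolSign (e i) * f s (z i)|) :=
        ENNReal.ofReal_le_ofReal hR
      _ = ENNReal.ofReal (4 * B) *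
          ∑ e : ι → Bool, ENNReal.ofReal (⨆ s, |∑ i, boolSign (e i) * f s (z i)|) := by
        rw [ENNReal.ofReal_mul (by positivity),
          ENNReal.ofReal_sum_of_nonneg fun e _ => Real.iSup_nonneg fun s => abs_nonneg _]
      _ ≤ ENNReal.ofReal (4 * B) * ∑ e, G e z := by
        gcongr with e
        exact ENNReal.ofReal_ciSup_le fun s => ofReal_abs_sign_sum_le (hfi s) (hc s) (hg s) e z
  have hGint : ∀ e, ∫⁻ z, G e z ∂Q =
      2 * ∫⁻ z, g z ∂Q + ENNReal.ofReal (|∑ i, boolSign (e i)| * c) := by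
    intro e
    have m1 := measurable_lintegral_mixSample P e hgm
    have m2 := measurable_lintegral_mixSample P (fun i => !e i) hgm
    rw [lintegral_add_right _ measurable_const, lintegral_add_left m1,
      lintegral_lintegral_mixSample P _ hgm, lintegral_lintegral_mixSample P _ hgm]
    simp [two_mul, Q]
  have hGm : ∀ e, Measurable (G e) := fun e =>
    ((measurable_lintegral_mixSample P e hgm).add
      (measurable_lintegral_mixSample P (fun i => !e i) hgm)).add_const _
  have hsgn : ∑ e : ι → Bool, ENNReal.ofReal (|∑ i, boolSign (e i)| * c) ≤
      N * ENNReal.ofReal (√(Fintype.card ι : ℝ) * c) := by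
    rw [← ENNReal.ofReal_sum_of_nonneg fun e _ => by positivity, ← Finset.sum_mul,
      show N = ENNReal.ofReal (Fintype.card (ι → Bool)) by simp [N],
      ← ENNReal.ofReal_mul (by positivity), ← mul_assoc]
    exact ENNReal.ofReal_le_ofReal (mul_le_mul_of_nonneg_right sum_abs_sign_sum_le hc0)
  have h2 : ∑ e, ∫⁻ z, H e z ∂Q ≤ ENNReal.ofReal (4 * B) *
      (N * (2 * ∫⁻ z, g z ∂Q + ENNReal.ofReal (√(Fintype.card ι : ℝ) * c))) := by
    rw [← lintegral_finsetSum' _ fun e _ => hH e]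
    refine (lintegral_mono hcontr).trans ?_
    rw [lintegral_const_mul _ (Finset.measurable_sum _ fun e _ => hGm e),
      lintegral_finsetSum _ fun e _ => hGm e]
    gcongr
    simp_rw [hGint]
    rw [Finset.sum_add_distrib, mul_add]
    refine add_le_add (le_of_eq ?_) hsgn
    rw [Finset.sum_const, nsmul_eq_mul, Finset.card_univ]
  have h3 : N * I ≤ N * (ENNReal.ofReal (Fintype.card ι * v) + ENNReal.ofReal (8 * B) *
      (2 * ∫⁻ z, g z ∂Q + ENNReal.ofReal (√(Fintype.card ι : ℝ) * c))) := by
    have h4 := Finset.sum_le_sum fun e (_ : e ∈ (Finset.univ : Finset (ι → Bool))) => h1 e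
    rw [Finset.sum_add_distrib, ← Finset.mul_sum, Finset.sum_const, Finset.sum_const,
      nsmul_eq_mul, nsmul_eq_mul, Finset.card_univ] at h4
    refine h4.trans ?_
    rw [mul_add]
    refine add_le_add le_rfl ((mul_le_mul_right h2 2).trans (le_of_eq ?_))
    rw [show 8 * B = 2 * (4 * B) by ring, ENNReal.ofReal_mul two_pos.le, ENNReal.ofReal_ofNat]
    ring
  exact (ENNReal.mul_le_mul_iff_right hN0 hNt).1 h3

end Symmetrization

/-! ### Peeling -/

lemma measure_ge_ofReal_le {α : Type*} [MeasurableSpace α] {μ : Measure α} {g : α → ENNReal}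
    (hg : Measurable g) {a w : ℝ} (ha : 0 < a) (hw : ∫⁻ x, g x ∂μ ≤ ENNReal.ofReal w) :
    μ {x | ENNReal.ofReal a ≤ g x} ≤ ENNReal.ofReal (w / a) := by
  rw [ENNReal.ofReal_div_of_pos ha]
  refine (meas_ge_le_lintegral_div hg.aemeasurable (by simpa using ha) ENNReal.ofReal_ne_top).trans
    ?_
  gcongr

/-- A geometric series of ratio `2 ^ (-ρ)`, with a prefactor `M ^ (-ρ)` that tends to 0. -/
lemma exists_tsum_ofReal_rpow_le {ρ K ε : ℝ} (hρ : 0 < ρ) (hK : 0 < K) (hε : 0 < ε) :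
    ∃ M : ℝ, 1 ≤ M ∧
      ∑' j : ℕ, ENNReal.ofReal (K * (2 ^ j * M) ^ (-ρ)) ≤ ENNReal.ofReal ε := by
  set b : ℝ := 2 ^ (-ρ)
  have hb0 : 0 < b := by positivity
  have hb1 : b < 1 := Real.rpow_lt_one_of_one_lt_of_neg one_lt_two (by linarith)
  have hpos : 0 < ε * (1 - b) / K := div_pos (mul_pos hε (by linarith)) hK
  obtain ⟨M, hM, hM1⟩ := (((tendsto_rpow_neg_atTop hρ).eventually_lt_const hpos).and
    (Filter.eventually_ge_atTop 1)).exists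
  refine ⟨M, hM1, ?_⟩
  have hM0 : 0 < M := by linarith
  have hterm : ∀ j : ℕ, K * (2 ^ j * M) ^ (-ρ) = K * M ^ (-ρ) * b ^ j := by
    intro j
    rw [Real.mul_rpow (by positivity) hM0.le, ← Real.rpow_natCast, ← Real.rpow_mul two_pos.le,
      mul_comm (j : ℝ), Real.rpow_mul two_pos.le, Real.rpow_natCast]
    ring
  simp_rw [hterm]
  have hsum : Summable fun j : ℕ => K * M ^ (-ρ) * b ^ j :=
    (summable_geometric_of_lt_one hb0.le hb1).mul_left _
  rw [← ENNReal.ofReal_tsum_of_nonneg (fun j => by positivity) hsum, tsum_mul_left,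
    tsum_geometric_of_lt_one hb0.le hb1]
  refine ENNReal.ofReal_le_ofReal ?_
  rw [← div_eq_mul_inv, div_le_iff₀ (by linarith)]
  rw [lt_div_iff₀ hK] at hM
  linarith

namespace MEst

variable {Θ 𝒵 : Type*} {n : ℕ}

lemma measurable_lossDiff [MeasurableSpace 𝒵] {m : Θ → 𝒵 → ℝ} (hm : ∀ θ, Measurable (m θ))
    (θ θ' : Θ) : Measurable (lossDiff m θ θ') := (hm θ).sub (hm θ')

lemma integral_lossDiff [MeasurableSpace 𝒵] {m : Θ → 𝒵 → ℝ} {P : Measure 𝒵}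
    (hi : ∀ θ, Integrable (m θ) P) (θ θ' : Θ) :
    ∫ z, lossDiff m θ θ' z ∂P = curvature m P θ' θ := integral_sub (hi θ) (hi θ')

lemma sum_sub_integral_eq [MeasurableSpace 𝒵] (P : Measure 𝒵) (hn : 1 ≤ n) (z : Fin n → 𝒵)
    (f : 𝒵 → ℝ) : ∑ i, (f (z i) - ∫ x, f x ∂P) = √(n : ℝ) * empG P z f := by
  have h0 : (n : ℝ) ≠ 0 := by positivity
  have h1 : √(n : ℝ) * √(n : ℝ) = n := Real.mul_self_sqrt (by positivity)
  rw [empG, empMean, ← mul_assoc, h1, mul_sub, mul_div_cancel₀ _ h0]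
  simp

lemma abs_integral_le_sqrt [MeasurableSpace 𝒵] {P : Measure 𝒵} [IsProbabilityMeasure P]
    {f : 𝒵 → ℝ} (hf : MemLp f 2 P) : |∫ z, f z ∂P| ≤ √(∫ z, f z ^ 2 ∂P) := by
  refine Real.abs_le_sqrt ?_
  have h := variance_nonneg f P
  rw [variance_eq_sub hf] at h
  simpa using h

lemma memLp_lossDiff [MeasurableSpace 𝒵] {P : Measure 𝒵} [IsProbabilityMeasure P]
    {m : Θ → 𝒵 → ℝ} (hm : ∀ θ, Measurable (m θ)) {B : ℝ}
    (hB : ∀ θ₁ θ₂ : Θ, ∀ z : 𝒵, |m θ₁ z - m θ₂ z| ≤ B) (θ θ' : Θ) :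
    MemLp (lossDiff m θ θ') 2 P :=
  MemLp.of_bound (measurable_lossDiff hm θ θ').aestronglyMeasurable B
    (ae_of_all _ fun z => hB θ θ' z)

variable [PseudoMetricSpace Θ] [MeasurableSpace 𝒵]

/-- Uniform control of the empirical process and of the empirical second moments over a ball. -/
lemma exists_event_ball {m : Θ → 𝒵 → ℝ} {P : Measure 𝒵} [IsProbabilityMeasure P]
    (hm : ∀ θ, Measurable (m θ)) {B : ℝ}
    (hB : ∀ θ₁ θ₂ : Θ, ∀ z : 𝒵, |m θ₁ z - m θ₂ z| ≤ B) (hn : 1 ≤ n) {θ₀ : Θ} {q : ℝ} {φ : ℝ → ℝ}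
    (hφ : LocalModulus m P θ₀ n q φ) (hsq : SquaresMeasurable m P θ₀ n) {δ t a η : ℝ}
    (hδ : 0 < δ) (ht : 0 < t) (ha : 0 < a) (ha1 : a ≤ 1) (hη : 0 < η) (hη1 : η ≤ 1)
    (hBt : B ≤ n * t) (hφt : φ δ ≤ √(n : ℝ) * t * a) :
    ∃ V : Set (Fin n → 𝒵), MeasurableSet V ∧
      (Measure.pi fun _ : Fin n => P) V ≤ ENNReal.ofReal (54 / η ^ 2 * a) ∧
      ∀ z ∉ V, ∀ θ ∈ Metric.ball θ₀ δ, |empG P z (lossDiff m θ θ₀)| ≤ η * √(n : ℝ) * t ∧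
        ∑ i, lossDiff m θ θ₀ (z i) ^ 2 ≤ (η * n * t) ^ 2 := by
  set Q := Measure.pi fun _ : Fin n => P
  have hn0 : (0 : ℝ) < n := by exact_mod_cast hn
  have hs0 : 0 < √(n : ℝ) := Real.sqrt_pos.2 hn0
  have hss : √(n : ℝ) * √(n : ℝ) = n := Real.mul_self_sqrt hn0.le
  obtain ⟨x₀⟩ : Nonempty 𝒵 := nonempty_of_isProbabilityMeasure P
  have hB0 : 0 ≤ B := (abs_nonneg _).trans (hB θ₀ θ₀ x₀)
  -- The factor 2 makes `φ δ < w` strict, so the infimum defining the outer expectation yields an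
  -- actual measurable majorant of integral below `w`.
  set w := 2 * (√(n : ℝ) * t * a) with hw
  have hp : 0 < √(n : ℝ) * t * a := by positivity
  have hw0 : 0 < w := by positivity
  have hφw : φ δ < w := by linarith
  have hlt := (hφ.maximal δ hδ).trans_lt ((ENNReal.ofReal_lt_ofReal_iff hw0).2 hφw)
  simp only [outerExpectation, iInf_lt_iff] at hlt
  obtain ⟨g, hgm, hg, hgw⟩ := hlt
  have hg' : ∀ θ ∈ Metric.ball θ₀ δ, ∀ z, ENNReal.ofReal |empG P z (lossDiff m θ θ₀)| ≤ g z :=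
    fun θ hθ z => (le_iSup₂ (f := fun θ (_ : θ ∈ Metric.ball θ₀ δ) =>
      ENNReal.ofReal |empG P z (lossDiff m θ θ₀)|) θ hθ).trans (hg z)
  have hsdw : ∀ θ ∈ Metric.ball θ₀ δ, √(∫ z, lossDiff m θ θ₀ z ^ 2 ∂P) ≤ w := fun θ hθ =>
    (hφ.variance δ hδ θ (Metric.ball_subset_closedBall hθ)).trans hφw.le
  have hmeas : ∀ e : Fin n → Bool, AEMeasurable (fun z : Fin n → 𝒵 =>
      ⨆ s : Metric.ball θ₀ δ,
        ENNReal.ofReal |∑ i, boolSign (e i) * lossDiff m s θ₀ (z i) ^ 2|) Q := by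
    intro e
    simpa only [iSup_subtype'] using
      hsq δ hδ (fun i => boolSign (e i)) fun i => boolSign_eq_or (e i)
  have hI := lintegral_iSup_sum_sq_le (ι := Fin n) (P := P)
    (f := fun s : Metric.ball θ₀ δ => lossDiff m s θ₀) (B := B) (v := w ^ 2) (c := w)
    (g := fun z => ENNReal.ofReal √(n : ℝ) * g z)
    (fun s => measurable_lossDiff hm _ _) (fun s z => hB _ _ z) ⟨θ₀, Metric.mem_ball_self hδ⟩
    (fun z => by simp [lossDiff])
    (fun s => (Real.sqrt_le_left hw0.le).1 (hsdw s s.2))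
    (fun s => (abs_integral_le_sqrt (memLp_lossDiff hm hB _ _)).trans (hsdw s s.2))
    hmeas (hgm.const_mul _)
    (fun s z => by
      rw [sum_sub_integral_eq P hn, abs_mul, abs_of_pos hs0, ENNReal.ofReal_mul hs0.le]
      exact mul_le_mul_right (hg' s s.2 z) _)
  -- Here 52 = 4 + 48: the variance part is `4 * (n * t) ^ 2 * a ^ 2` with `a ^ 2 ≤ a`, and the
  -- contraction part is `48 * B * n * t * a` with `B ≤ n * t`.
  have hIle : ∫⁻ z : Fin n → 𝒵, ⨆ s : Metric.ball θ₀ δ,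
      ENNReal.ofReal (∑ i, lossDiff m s θ₀ (z i) ^ 2) ∂Q ≤
        ENNReal.ofReal (52 * (n * t) ^ 2 * a) := by
    refine hI.trans ?_
    rw [lintegral_const_mul _ hgm, Fintype.card_fin]
    have h1 : 2 * (ENNReal.ofReal √(n : ℝ) * ∫⁻ z, g z ∂Q) + ENNReal.ofReal (√(n : ℝ) * w) ≤
        ENNReal.ofReal (3 * (√(n : ℝ) * w)) := by
      calc 2 * (ENNReal.ofReal √(n : ℝ) * ∫⁻ z, g z ∂Q) + ENNReal.ofReal (√(n : ℝ) * w)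
          ≤ 2 * (ENNReal.ofReal √(n : ℝ) * ENNReal.ofReal w) + ENNReal.ofReal (√(n : ℝ) * w) := by
            gcongr
        _ = ENNReal.ofReal (3 * (√(n : ℝ) * w)) := by
          rw [← ENNReal.ofReal_mul hs0.le, ← ENNReal.ofReal_ofNat 2,
            ← ENNReal.ofReal_mul (by norm_num), ← ENNReal.ofReal_add (by positivity)
            (by positivity)]
          congr 1
          ring
    refine (add_le_add le_rfl (mul_le_mul_right h1 _)).trans ?_
    rw [← ENNReal.ofReal_mul (by positivity), ← ENNReal.ofReal_add (by positivity)
      (by positivity)]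
    refine ENNReal.ofReal_le_ofReal ?_
    have e1 : (n : ℝ) * w ^ 2 = 4 * (n * t) ^ 2 * (a * a) := by
      rw [hw]; linear_combination (4 * n * t ^ 2 * a ^ 2) * hss
    have e2 : 8 * B * (3 * (√(n : ℝ) * w)) = B * (48 * (n * t) * a) := by
      rw [hw]; linear_combination (48 * B * t * a) * hss
    rw [e1, e2]
    have e3 : 4 * (n * t) ^ 2 * (a * a) ≤ 4 * (n * t) ^ 2 * a :=
      mul_le_mul_of_nonneg_left (by nlinarith) (by positivity)
    have e4 : B * (48 * (n * t) * a) ≤ (n * t) * (48 * (n * t) * a) :=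
      mul_le_mul_of_nonneg_right hBt (by positivity)
    linarith
  have hHm : AEMeasurable (fun z : Fin n → 𝒵 => ⨆ s : Metric.ball θ₀ δ,
      ENNReal.ofReal (∑ i, lossDiff m s θ₀ (z i) ^ 2)) Q := by
    have h := hmeas fun _ => true
    have heq : ∀ (s : Metric.ball θ₀ δ) (z : Fin n → 𝒵),
        |∑ i, boolSign true * lossDiff m s θ₀ (z i) ^ 2| = ∑ i, lossDiff m s θ₀ (z i) ^ 2 := by
      intro s z
      simp only [boolSign, if_true, one_mul]
      exact abs_of_nonneg (Finset.sum_nonneg fun i _ => sq_nonneg _)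
    simpa only [heq] using h
  obtain ⟨h, hhm, hle, hint⟩ := exists_measurable_majorant hHm
  have hA1 : 0 < η * √(n : ℝ) * t := by positivity
  have hA2 : 0 < (η * n * t) ^ 2 := by positivity
  refine ⟨{z | ENNReal.ofReal (η * √(n : ℝ) * t) ≤ g z} ∪ {z | ENNReal.ofReal ((η * n * t) ^ 2) ≤ h z},
    (measurableSet_le measurable_const hgm).union (measurableSet_le measurable_const hhm), ?_, ?_⟩
  · refine (measure_union_le _ _).trans ((add_le_add (measure_ge_ofReal_le hgm hA1 hgw.le)
      (measure_ge_ofReal_le hhm hA2 (hint.trans_le hIle))).trans ?_)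
    rw [← ENNReal.ofReal_add (by positivity) (by positivity)]
    refine ENNReal.ofReal_le_ofReal ?_
    have e1 : w / (η * √(n : ℝ) * t) = 2 / η * a := by rw [hw]; field_simp
    have e2 : 52 * (n * t) ^ 2 * a / (η * n * t) ^ 2 = 52 / η ^ 2 * a := by field_simp
    have e3 : 2 / η ≤ 2 / η ^ 2 := by
      apply div_le_div_of_nonneg_left two_pos.le (by positivity)
      nlinarith
    rw [e1, e2]
    calc 2 / η * a + 52 / η ^ 2 * a ≤ 2 / η ^ 2 * a + 52 / η ^ 2 * a := by gcongr
      _ = 54 / η ^ 2 * a := by ring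
  · intro z hz θ hθ
    simp only [Set.mem_union, Set.mem_ofPred_eq, not_or, not_le] at hz
    constructor
    · have := (hg' θ hθ z).trans_lt hz.1
      exact ((ENNReal.ofReal_lt_ofReal_iff hA1).1 this).le
    · have h1 := (le_iSup (fun s : Metric.ball θ₀ δ =>
        ENNReal.ofReal (∑ i, lossDiff m s θ₀ (z i) ^ 2)) ⟨θ, hθ⟩).trans (hle z)
      exact ((ENNReal.ofReal_lt_ofReal_iff hA2).1 (h1.trans_lt hz.2)).le

/-- Growth of the modulus along the shells. -/
lemma LocalModulus.le_of_rate {m : Θ → 𝒵 → ℝ} {P : Measure 𝒵} {θ₀ : Θ} {q : ℝ} {φ : ℝ → ℝ}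
    (hφ : LocalModulus m P θ₀ n q φ) {β c₀ r x τ : ℝ} (hβ : 0 ≤ β) (hq : q < 1 + β) (hc : 0 < c₀)
    (hr : 0 < r) (hrate : (r ^ 2)⁻¹ * φ (c₀ ^ (-(1 / (1 + β))) * r ^ (2 / (1 + β))) ≤ √(n : ℝ))
    (hx : 1 ≤ x) (hτ : r ^ 2 ≤ τ) :
    φ ((x * τ / c₀) ^ (1 + β)⁻¹) ≤ √(n : ℝ) * (x * τ) * x ^ (-(1 - q / (1 + β))) := by
  have hb : 0 < 1 + β := by linarith
  have hr2 : 0 < r ^ 2 := by positivity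
  have hτ0 : 0 < τ := by linarith
  have hx0 : 0 < x := by linarith
  have hρ : c₀ ^ (-(1 / (1 + β))) * r ^ (2 / (1 + β)) = (r ^ 2 / c₀) ^ (1 + β)⁻¹ := by
    rw [Real.div_rpow hr2.le hc.le, ← Real.rpow_natCast r 2, ← Real.rpow_mul hr.le,
      Real.rpow_neg hc.le, one_div, div_eq_inv_mul _ (c₀ ^ _)]
    norm_num [div_eq_mul_inv]
  rw [hρ] at hrate
  set ρ := (r ^ 2 / c₀) ^ (1 + β)⁻¹
  set δ := (x * τ / c₀) ^ (1 + β)⁻¹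
  have hρ0 : 0 < ρ := by positivity
  have hδ0 : 0 < δ := by positivity
  have hrx : r ^ 2 ≤ x * τ := by nlinarith
  have hρδ : ρ ≤ δ := Real.rpow_le_rpow (by positivity) (by gcongr) (by positivity)
  have hφρ : φ ρ ≤ √(n : ℝ) * r ^ 2 := by
    rw [inv_mul_le_iff₀ hr2] at hrate
    linarith
  have hanti := hφ.antitone (Set.mem_Ioi.2 hρ0) (Set.mem_Ioi.2 hδ0) hρδ
  dsimp only at hanti
  have hratio : (δ / ρ) ^ q = (x * τ / r ^ 2) ^ (q / (1 + β)) := by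
    rw [← Real.div_rpow (by positivity) (by positivity), ← Real.rpow_mul (by positivity)]
    congr 1
    · field_simp
    · field_simp
  have h1 : φ δ ≤ φ ρ * (δ / ρ) ^ q := by
    rw [div_le_iff₀ (by positivity)] at hanti
    rw [Real.div_rpow hδ0.le hρ0.le]
    calc φ δ ≤ _ := hanti
      _ = _ := by ring
  -- Extracting one full power leaves a negative exponent, for which the base `x * τ / r ^ 2` may be
  -- lowered to `x`.
  have h2 : r ^ 2 * (x * τ / r ^ 2) ^ (q / (1 + β)) =
      x * τ * (x * τ / r ^ 2) ^ (-(1 - q / (1 + β))) := by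
    have hy : 0 < x * τ / r ^ 2 := by positivity
    rw [show -(1 - q / (1 + β)) = q / (1 + β) - 1 by ring, Real.rpow_sub_one hy.ne']
    field_simp
  have h3 : (x * τ / r ^ 2) ^ (-(1 - q / (1 + β))) ≤ x ^ (-(1 - q / (1 + β))) := by
    refine Real.rpow_le_rpow_of_nonpos hx0 ?_ ?_
    · rw [le_div_iff₀ hr2]
      gcongr
    · have : q / (1 + β) < 1 := (div_lt_one hb).2 hq
      linarith
  calc φ δ ≤ φ ρ * (δ / ρ) ^ q := h1
    _ ≤ √(n : ℝ) * r ^ 2 * (δ / ρ) ^ q := by gcongr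
    _ = √(n : ℝ) * (x * τ * (x * τ / r ^ 2) ^ (-(1 - q / (1 + β)))) := by
      rw [hratio, mul_assoc, h2]
    _ ≤ √(n : ℝ) * (x * τ * x ^ (-(1 - q / (1 + β)))) := by gcongr
    _ = _ := by ring

/-- Uniform control, over the whole parameter space, of the empirical process and of the empirical
second moments. -/
lemma exists_event_empirical {m : Θ → 𝒵 → ℝ} {P : Measure 𝒵} [IsProbabilityMeasure P]
    (hm : ∀ θ, Measurable (m θ)) {B : ℝ}
    (hB : ∀ θ₁ θ₂ : Θ, ∀ z : 𝒵, |m θ₁ z - m θ₂ z| ≤ B) (hn : 1 ≤ n) {θ₀ : Θ} {q : ℝ} {φ : ℝ → ℝ}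
    (hφ : LocalModulus m P θ₀ n q φ) (hsq : SquaresMeasurable m P θ₀ n)
    {β c₀ r η ε M : ℝ} (hβ : 0 ≤ β) (hq : q < 1 + β) (hc : 0 < c₀) (hr : 0 < r)
    (hrate : (r ^ 2)⁻¹ * φ (c₀ ^ (-(1 / (1 + β))) * r ^ (2 / (1 + β))) ≤ √(n : ℝ))
    (hη : 0 < η) (hη1 : η ≤ 1) (hM1 : 1 ≤ M)
    (hM : ∑' j : ℕ, ENNReal.ofReal (54 / η ^ 2 * (2 ^ j * M) ^ (-(1 - q / (1 + β)))) ≤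
      ENNReal.ofReal ε) :
    ∃ V : Set (Fin n → 𝒵), MeasurableSet V ∧
      (Measure.pi fun _ : Fin n => P) V ≤ ENNReal.ofReal ε ∧
      ∀ z ∉ V, ∀ θ, ∃ t, 0 ≤ t ∧ t ≤ M * (r ^ 2 + B / n) + 2 * (c₀ * dist θ θ₀ ^ (1 + β)) ∧
        |empG P z (lossDiff m θ θ₀)| ≤ η * √(n : ℝ) * t ∧
        ∑ i, lossDiff m θ θ₀ (z i) ^ 2 ≤ (η * n * t) ^ 2 := by
  have hn0 : (0 : ℝ) < n := by exact_mod_cast hn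
  have hb : 0 < 1 + β := by linarith
  have hκ : 0 < 1 - q / (1 + β) := by
    have : q / (1 + β) < 1 := (div_lt_one hb).2 hq
    linarith
  obtain ⟨x₀⟩ : Nonempty 𝒵 := nonempty_of_isProbabilityMeasure P
  have hB0 : 0 ≤ B := (abs_nonneg _).trans (hB θ₀ θ₀ x₀)
  have hM0 : 0 < M := by linarith
  set τ := r ^ 2 + B / n with hτ
  have hτr : r ^ 2 ≤ τ := by
    have : 0 ≤ B / n := by positivity
    linarith
  have hτ0 : 0 < τ := lt_of_lt_of_le (by positivity) hτr
  have hx1 : ∀ j : ℕ, 1 ≤ 2 ^ j * M := fun j =>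
    one_le_mul_of_one_le_of_one_le (one_le_pow₀ one_le_two) hM1
  have hBt : ∀ j : ℕ, B ≤ n * (2 ^ j * M * τ) := by
    intro j
    have h1 : B ≤ n * τ := by
      rw [hτ, mul_add, mul_div_cancel₀ _ hn0.ne']
      have : 0 ≤ (n : ℝ) * r ^ 2 := by positivity
      linarith
    have h2 : (n : ℝ) * τ ≤ n * (2 ^ j * M * τ) :=
      mul_le_mul_of_nonneg_left (le_mul_of_one_le_left hτ0.le (hx1 j)) hn0.le
    linarith
  -- The radius is chosen so that the ball is exactly the set where `c₀ * dist θ θ₀ ^ (1 + β) < t`.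
  have hev : ∀ j : ℕ, _ := fun j =>
    exists_event_ball (t := 2 ^ j * M * τ) (δ := (2 ^ j * M * τ / c₀) ^ (1 + β)⁻¹)
      (a := (2 ^ j * M) ^ (-(1 - q / (1 + β)))) (η := η) hm hB hn hφ hsq (by positivity)
      (by positivity) (by positivity)
      (Real.rpow_le_one_of_one_le_of_nonpos (hx1 j) (by linarith)) hη hη1 (hBt j)
      (hφ.le_of_rate hβ hq hc hr hrate (hx1 j) hτr)
  choose V hVm hVle hV using hev
  refine ⟨⋃ j, V j, MeasurableSet.iUnion hVm,
    (measure_iUnion_le _).trans ((ENNReal.tsum_le_tsum hVle).trans hM), fun z hz θ => ?_⟩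
  simp only [Set.mem_iUnion, not_exists] at hz
  set D := c₀ * dist θ θ₀ ^ (1 + β)
  have hD0 : 0 ≤ D := by positivity
  have hex : ∃ j : ℕ, D < 2 ^ j * M * τ := by
    obtain ⟨j, hj⟩ := pow_unbounded_of_one_lt (D / (M * τ)) (one_lt_two (α := ℝ))
    refine ⟨j, ?_⟩
    rwa [div_lt_iff₀ (by positivity), ← mul_assoc] at hj
  classical
  have hj := Nat.find_spec hex
  have hmin := fun k => Nat.find_min hex (m := k)
  set j := Nat.find hex
  have hball : θ ∈ Metric.ball θ₀ ((2 ^ j * M * τ / c₀) ^ (1 + β)⁻¹) := by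
    rw [Metric.mem_ball, Real.lt_rpow_inv_iff_of_pos dist_nonneg (by positivity) hb,
      lt_div_iff₀ hc]
    linarith
  obtain ⟨h1, h2⟩ := hV j z (hz j) θ hball
  refine ⟨2 ^ j * M * τ, by positivity, ?_, h1, h2⟩
  -- For the smallest admissible scale, either `t = M * τ`, or half of `t` fails to exceed `D` and
  -- so `t ≤ 2 * D`.
  rcases hj0 : j with _ | k
  · simp only [pow_zero, one_mul]
    linarith
  · have hk := hmin k (by omega)
    rw [not_lt] at hk
    have : 0 < M * τ := by positivity
    rw [pow_succ]
    linarith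

end MEst

/-! ### The initial estimator -/

namespace MEst

variable {Θ 𝒵 𝒟 : Type*} {n : ℕ} [MeasurableSpace 𝒵] [MeasurableSpace 𝒟]

/-- By independence the left-hand side is the variance of `f`. -/
lemma integral_empG_sq_le {P : Measure 𝒵} [IsProbabilityMeasure P] (hn : 1 ≤ n) {f : 𝒵 → ℝ}
    (hf : MemLp f 2 P) :
    ∫ z : Fin n → 𝒵, empG P z f ^ 2 ∂(Measure.pi fun _ : Fin n => P) ≤ ∫ z, f z ^ 2 ∂P := by
  have hn0 : (0 : ℝ) < n := by exact_mod_cast hn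
  have hfi : Integrable f P := hf.integrable one_le_two
  have hvar := variance_sum_pi (μ := fun _ : Fin n => P) (X := fun _ => f) fun _ => hf
  have hLp : ∀ i : Fin n, MemLp (fun z : Fin n → 𝒵 => f (z i)) 2 (Measure.pi fun _ => P) :=
    fun i => hf.comp_measurePreserving (measurePreserving_eval _ i)
  have hae : AEMeasurable (∑ i, fun z : Fin n → 𝒵 => f (z i)) (Measure.pi fun _ => P) :=
    (memLp_finsetSum' _ fun i _ => hLp i).aestronglyMeasurable.aemeasurable
  rw [variance_eq_integral hae] at hvar
  have hmean : ∫ z : Fin n → 𝒵, (∑ i, fun z : Fin n → 𝒵 => f (z i)) z ∂(Measure.pi fun _ => P) =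
      n * ∫ z, f z ∂P := by
    simp_rw [Finset.sum_apply]
    rw [integral_finsetSum _ fun i _ => integrable_eval_pi hfi i]
    simp [integral_eval_pi hfi]
  rw [hmean] at hvar
  have hG : ∀ z : Fin n → 𝒵, empG P z f ^ 2 =
      (n : ℝ)⁻¹ * ((∑ i, fun z : Fin n → 𝒵 => f (z i)) z - n * ∫ z, f z ∂P) ^ 2 := by
    intro z
    rw [empG, empMean, mul_pow, Real.sq_sqrt hn0.le, Finset.sum_apply]
    field_simp
  simp_rw [hG]
  rw [integral_const_mul, hvar]
  simp only [Finset.sum_const, Finset.card_univ, Fintype.card_fin, nsmul_eq_mul]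
  rw [inv_mul_cancel_left₀ hn0.ne', variance_eq_sub hf]
  simp only [Pi.pow_apply]
  linarith [sq_nonneg (∫ z, f z ∂P)]

/-- Markov's inequality for the sum of the squared empirical process and of the empirical second
moment, at a single function. -/
lemma measure_empG_sq_add_empMean_sq_gt_le {P : Measure 𝒵} [IsProbabilityMeasure P] (hn : 1 ≤ n)
    {f : 𝒵 → ℝ} (hf : Measurable f) {B : ℝ} (hB : ∀ z, |f z| ≤ B) {K : ℝ} (hK : 0 < K) :
    (Measure.pi fun _ : Fin n => P)
      {z | K * (2 * ∫ x, f x ^ 2 ∂P) < empG P z f ^ 2 + empMean z fun x => f x ^ 2} ≤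
      ENNReal.ofReal K⁻¹ := by
  set Q := Measure.pi fun _ : Fin n => P
  have hn0 : (0 : ℝ) < n := by exact_mod_cast hn
  have hLp : MemLp f 2 P := MemLp.of_bound hf.aestronglyMeasurable B (ae_of_all _ hB)
  have hf2 : Integrable (fun x => f x ^ 2) P := hLp.integrable_sq
  set v := ∫ x, f x ^ 2 ∂P
  have hv0 : 0 ≤ v := integral_nonneg fun x => sq_nonneg _
  set X : (Fin n → 𝒵) → ℝ := fun z => empG P z f ^ 2 + empMean z fun x => f x ^ 2
  have hX0 : ∀ z, 0 ≤ X z := fun z => add_nonneg (sq_nonneg _)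
    (div_nonneg (Finset.sum_nonneg fun i _ => sq_nonneg _) hn0.le)
  have hGi : Integrable (fun z : Fin n → 𝒵 => empG P z f ^ 2) Q := by
    have h1 : MemLp (fun z : Fin n → 𝒵 => ∑ i, f (z i)) 2 Q := memLp_finsetSum _ fun i _ =>
      hLp.comp_measurePreserving (measurePreserving_eval (fun _ : Fin n => P) i)
    have h2 := ((h1.const_mul (n : ℝ)⁻¹).sub (memLp_const (∫ x, f x ∂P))).const_mul √(n : ℝ)
    refine h2.integrable_sq.congr (ae_of_all _ fun z => ?_)
    simp only [empG, empMean, div_eq_inv_mul, Pi.sub_apply]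
  have hMi : Integrable (fun z : Fin n → 𝒵 => empMean z fun x => f x ^ 2) Q :=
    (integrable_finsetSum _ fun i _ => integrable_eval_pi hf2 i).div_const _
  have hXi : Integrable X Q := hGi.add hMi
  have hMint : ∫ z : Fin n → 𝒵, (empMean z fun x => f x ^ 2) ∂Q = v := by
    unfold empMean
    rw [integral_div, integral_finsetSum _ fun i _ => integrable_eval_pi hf2 i]
    simp only [integral_eval_pi hf2]
    simp only [Finset.sum_const, Finset.card_univ, Fintype.card_fin, nsmul_eq_mul]
    exact mul_div_cancel_left₀ _ hn0.ne'
  have hXle : ∫ z, X z ∂Q ≤ 2 * v := by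
    have h := integral_empG_sq_le hn hLp
    rw [integral_add hGi hMi, hMint]
    linarith
  -- If the second moment vanishes, Markov gives nothing, but the statistic is almost surely 0; the
  -- strict inequality in the event is what saves this case.
  rcases hv0.eq_or_lt with h0 | hpos
  · have hzero : ∫ z, X z ∂Q = 0 :=
      le_antisymm (by linarith) (integral_nonneg hX0)
    have hae := (integral_eq_zero_iff_of_nonneg hX0 hXi).1 hzero
    have : Q {z | K * (2 * v) < X z} = 0 := by
      refine measure_mono_null (fun z hz => ?_) hae
      simp only [Set.mem_ofPred_eq, ← h0] at hz
      simp only [Set.mem_compl_iff, Set.mem_ofPred_eq, Pi.zero_apply]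
      intro h
      rw [h] at hz
      simp at hz
    rw [this]
    exact zero_le
  · have hmk := mul_meas_ge_le_integral_of_nonneg (ae_of_all Q hX0) hXi (K * (2 * v))
    have hmk' : Q.real {z | K * (2 * v) ≤ X z} ≤ K⁻¹ := by
      have h1 : K * (2 * v) * Q.real {z | K * (2 * v) ≤ X z} ≤ 2 * v := hmk.trans hXle
      rw [← one_div, le_div_iff₀ hK]
      nlinarith
    refine (measure_mono fun z hz => ?_).trans
      ((ENNReal.le_ofReal_iff_toReal_le (measure_ne_top Q _) (by positivity)).2 hmk')
    exact (show K * (2 * v) < X z from hz).le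

/-- For fixed first data the loss difference is one fixed function, and Markov's bound does not
depend on it; Fubini then integrates it over the first data. -/
lemma exists_event_initial {P : Measure 𝒵} [IsProbabilityMeasure P] {ν : Measure 𝒟}
    [IsProbabilityMeasure ν] {m : Θ → 𝒵 → ℝ} (hm : ∀ θ, Measurable (m θ)) {B : ℝ}
    (hB : ∀ θ₁ θ₂ : Θ, ∀ z : 𝒵, |m θ₁ z - m θ₂ z| ≤ B) (hn : 1 ≤ n) {θhat : 𝒟 → Θ}
    (hθ : Measurable fun p : 𝒟 × 𝒵 => m (θhat p.1) p.2) (θ₀ : Θ) {K : ℝ} (hK : 0 < K) :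
    ∃ W : Set (𝒟 × (Fin n → 𝒵)), MeasurableSet W ∧
      (ν.prod (Measure.pi fun _ : Fin n => P)) W ≤ ENNReal.ofReal K⁻¹ ∧
      ∀ p ∉ W, empG P p.2 (lossDiff m (θhat p.1) θ₀) ^ 2 +
        (empMean p.2 fun x => lossDiff m (θhat p.1) θ₀ x ^ 2) ≤
          K * (2 * ∫ x, lossDiff m (θhat p.1) θ₀ x ^ 2 ∂P) := by
  have hg : Measurable fun p : 𝒟 × 𝒵 => lossDiff m (θhat p.1) θ₀ p.2 :=
    hθ.sub ((hm θ₀).comp measurable_snd)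
  have hi : ∀ i, Measurable fun p : 𝒟 × (Fin n → 𝒵) => lossDiff m (θhat p.1) θ₀ (p.2 i) :=
    fun i => hg.comp (measurable_fst.prodMk measurable_snd.eval)
  have hI : Measurable fun p : 𝒟 × (Fin n → 𝒵) => ∫ x, lossDiff m (θhat p.1) θ₀ x ∂P :=
    (hg.stronglyMeasurable.integral_prod_right' (ν := P)).measurable.comp measurable_fst
  have hI2 : Measurable fun p : 𝒟 × (Fin n → 𝒵) => ∫ x, lossDiff m (θhat p.1) θ₀ x ^ 2 ∂P :=
    ((hg.pow_const 2).stronglyMeasurable.integral_prod_right' (ν := P)).measurable.comp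
      measurable_fst
  have hX : Measurable fun p : 𝒟 × (Fin n → 𝒵) => empG P p.2 (lossDiff m (θhat p.1) θ₀) ^ 2 +
      (empMean p.2 fun x => lossDiff m (θhat p.1) θ₀ x ^ 2) := by
    unfold empG empMean
    refine Measurable.add (((((Finset.measurable_sum _ fun i _ => hi i).div_const _).sub
      hI).const_mul _).pow_const 2) ?_
    exact (Finset.measurable_sum _ fun i _ => (hi i).pow_const 2).div_const _
  have hW := measurableSet_lt ((hI2.const_mul 2).const_mul K) hX
  refine ⟨_, hW, ?_, fun p hp => not_lt.1 hp⟩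
  rw [Measure.prod_apply hW]
  refine (lintegral_mono fun d => measure_empG_sq_add_empMean_sq_gt_le (P := P) hn
    (measurable_lossDiff hm (θhat d) θ₀) (hB _ _) hK).trans ?_
  simp

end MEst

/-! ### The diameter of the confidence set -/

/-- Absorption: `t / 4` contains at most `D / 2`, so the other terms are doubled. -/
lemma le_mul_add_of_le {D M τ b t C₁ a u s L : ℝ} (hD : D ≤ t / 4 + C₁ + u * a + 5 * L * b)
    (ht : t ≤ M * τ + 2 * D) (hs : a + C₁ ≤ s) (hC₁ : 0 ≤ C₁) (ha : 0 ≤ a) (hu : 0 ≤ u)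
    (hM : 0 ≤ M) (hb : b ≤ τ) (hL : 0 ≤ L) (hτ : 0 ≤ τ) :
    D ≤ (M / 2 + 2 * (1 + u) + 10 * L) * (τ + s) := by
  have hs0 : 0 ≤ s := by linarith
  have h1 : u * a ≤ u * s := mul_le_mul_of_nonneg_left (by linarith) hu
  have h2 : L * b ≤ L * τ := mul_le_mul_of_nonneg_left hb hL
  have h3 := mul_nonneg hM hs0
  have h4 := mul_nonneg hu hτ
  have h5 := mul_nonneg hL hs0
  linarith

namespace MEst

variable {Θ 𝒵 : Type*} {n : ℕ}

lemma empMean_eq_add [MeasurableSpace 𝒵] (P : Measure 𝒵) (hn : 1 ≤ n) (z : Fin n → 𝒵)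
    (f : 𝒵 → ℝ) : empMean z f = ∫ x, f x ∂P + empG P z f / √(n : ℝ) := by
  have h : √(n : ℝ) ≠ 0 := (Real.sqrt_pos.2 (by exact_mod_cast hn)).ne'
  rw [empG, mul_div_cancel_left₀ _ h]
  ring

lemma empMean_lossDiff_sub (m : Θ → 𝒵 → ℝ) (z : Fin n → 𝒵) (θ θ₁ θ₀ : Θ) :
    empMean z (lossDiff m θ θ₁) = empMean z (lossDiff m θ θ₀) - empMean z (lossDiff m θ₁ θ₀) := by
  simp only [empMean, lossDiff, ← sub_div, ← Finset.sum_sub_distrib]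
  congr 1
  exact Finset.sum_congr rfl fun i _ => by ring

/-- Centering lowers the sum of squares, splitting at `θ₀` costs a factor 2, and so does `n / (n -
1) ≤ 2`. -/
lemma sampleVar_lossDiff_le (m : Θ → 𝒵 → ℝ) (hn : 2 ≤ n) (z : Fin n → 𝒵) (θ θ₁ θ₀ : Θ) :
    sampleVar z (lossDiff m θ θ₁) ≤ 4 * ((empMean z fun x => lossDiff m θ θ₀ x ^ 2) +
      empMean z fun x => lossDiff m θ₁ θ₀ x ^ 2) := by
  have hn2 : (2 : ℝ) ≤ n := by exact_mod_cast hn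
  have hn0 : (0 : ℝ) < n := by linarith
  set h := lossDiff m θ θ₁ with hh
  have h1 : ∑ i, (h (z i) - empMean z h) ^ 2 ≤ ∑ i, h (z i) ^ 2 := by
    have e : ∑ i, (h (z i) - empMean z h) ^ 2 = ∑ i, h (z i) ^ 2 - n * empMean z h ^ 2 := by
      have hs : ∑ i, h (z i) = n * empMean z h := by
        rw [empMean, mul_div_cancel₀ _ hn0.ne']
      simp_rw [sub_sq, Finset.sum_add_distrib, Finset.sum_sub_distrib]
      rw [← Finset.sum_mul, ← Finset.mul_sum, hs]
      simp
      ring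
    rw [e]
    have : 0 ≤ n * empMean z h ^ 2 := by positivity
    linarith
  have h2 : ∑ i, h (z i) ^ 2 ≤
      2 * (∑ i, lossDiff m θ θ₀ (z i) ^ 2 + ∑ i, lossDiff m θ₁ θ₀ (z i) ^ 2) := by
    rw [← Finset.sum_add_distrib, Finset.mul_sum]
    refine Finset.sum_le_sum fun i _ => ?_
    simp only [hh, lossDiff]
    nlinarith [sq_nonneg (m θ (z i) - m θ₀ (z i) + (m θ₁ (z i) - m θ₀ (z i)))]
  have h3 : 0 ≤ ∑ i, lossDiff m θ θ₀ (z i) ^ 2 + ∑ i, lossDiff m θ₁ θ₀ (z i) ^ 2 := by positivity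
  simp only [sampleVar, empMean] at h1 ⊢
  rw [div_le_iff₀ (by linarith), ← add_div, mul_div_assoc', div_mul_eq_mul_div, le_div_iff₀ hn0]
  nlinarith

variable [PseudoMetricSpace Θ] [MeasurableSpace 𝒵]

/-- On the good event, the points of the confidence set are close to the target. -/
lemma mul_dist_rpow_le_of_mem_ebSet {m : Θ → 𝒵 → ℝ} {P : Measure 𝒵} [IsProbabilityMeasure P]
    (hi : ∀ θ, Integrable (m θ) P) {B : ℝ}
    (hB : ∀ θ₁ θ₂ : Θ, ∀ z : 𝒵, |m θ₁ z - m θ₂ z| ≤ B) (hn : 1 ≤ n) {θ₀ θ₁ θ : Θ}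
    {c₀ β α₁ K M η t τ s : ℝ} (hc : 0 < c₀) (hmar : MarginCondition m P θ₀ c₀ β)
    {U : Θ → Θ → (Fin n → 𝒵) → ℝ} {z : Fin n → 𝒵} (hmem : θ ∈ ebSet m B α₁ U θ₁ z)
    (hL : 0 < Real.log (2 / α₁)) (hK : 0 < K) (hM : 0 ≤ M)
    (hη : (1 + √(8 * Real.log (2 / α₁))) * η = 1 / 4) (hη0 : 0 ≤ η) (ht : 0 ≤ t)
    (htM : t ≤ M * τ + 2 * (c₀ * dist θ θ₀ ^ (1 + β))) (hτ : B / n ≤ τ)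
    (hG : |empG P z (lossDiff m θ θ₀)| ≤ η * √(n : ℝ) * t)
    (hS : ∑ i, lossDiff m θ θ₀ (z i) ^ 2 ≤ (η * n * t) ^ 2)
    (hI : empG P z (lossDiff m θ₁ θ₀) ^ 2 + (empMean z fun x => lossDiff m θ₁ θ₀ x ^ 2) ≤
      K * (2 * ∫ x, lossDiff m θ₁ θ₀ x ^ 2 ∂P))
    (hs : initialError m P θ₀ n θ₁ ≤ s) :
    c₀ * dist θ θ₀ ^ (1 + β) ≤
      (M / 2 + 2 * (1 + (1 + √(8 * Real.log (2 / α₁))) * √(2 * K)) + 10 * Real.log (2 / α₁)) *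
        (τ + s) := by
  have hn0 : (0 : ℝ) < n := by exact_mod_cast hn
  have hs0 : 0 < √(n : ℝ) := Real.sqrt_pos.2 hn0
  have hss : √(n : ℝ) ^ 2 = n := Real.sq_sqrt hn0.le
  obtain ⟨x₀⟩ : Nonempty 𝒵 := nonempty_of_isProbabilityMeasure P
  have hB0 : 0 ≤ B := (abs_nonneg _).trans (hB θ₀ θ₀ x₀)
  have hBn : 0 ≤ B / n := by positivity
  have hD := hmar θ
  set D := c₀ * dist θ θ₀ ^ (1 + β)
  set L := Real.log (2 / α₁)
  set k := √(2 * K)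
  set l := √(8 * L)
  have hk0 : 0 ≤ k := Real.sqrt_nonneg _
  have hl0 : 0 ≤ l := Real.sqrt_nonneg _
  have hC₁ : 0 ≤ curvature m P θ₀ θ₁ := le_trans (by positivity) (hmar θ₁)
  set C₁ := curvature m P θ₀ θ₁
  set v := ∫ x, lossDiff m θ₁ θ₀ x ^ 2 ∂P
  have hv0 : 0 ≤ v := integral_nonneg fun x => sq_nonneg _
  set a := (√(n : ℝ))⁻¹ * √v
  have ha0 : 0 ≤ a := by positivity
  have hsa : √(n : ℝ) * a = √v := mul_inv_cancel_left₀ hs0.ne' _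
  have has : a + C₁ ≤ s := hs
  have hlk : 0 ≤ (1 + l) * k := by positivity
  have hs0' : 0 ≤ s := by linarith
  have hτ0 : 0 ≤ τ := hBn.trans hτ
  -- For `n = 1` the set is unrestricted, but the curvature is at most `B = B / n ≤ τ`.
  rcases Nat.lt_or_ge n 2 with hn1 | hn2
  · obtain rfl : n = 1 := by omega
    have h1 : curvature m P θ₀ θ ≤ B := by
      rw [← integral_lossDiff hi]
      refine (le_abs_self _).trans ?_
      have := norm_integral_le_of_norm_le_const (μ := P) (f := lossDiff m θ θ₀) (C := B)
        (ae_of_all _ fun z => hB θ θ₀ z)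
      simpa using this
    have h2 : D ≤ τ + s := by
      rw [Nat.cast_one, div_one] at hτ
      linarith
    exact h2.trans (le_mul_of_one_le_left (by linarith) (by linarith))
  · have hn2' : (2 : ℝ) ≤ n := by exact_mod_cast hn2
    have hset := hmem hn2
    -- This sign is all that is used about the upper confidence bound.
    have hU : min 0 (U θ θ₁ z) ≤ 0 := min_le_left _ _
    have hv : K * (2 * v) = (k * √v) ^ 2 := by
      rw [mul_pow, Real.sq_sqrt hv0, Real.sq_sqrt (by positivity)]
      ring
    rw [hv] at hI
    have hM0 : 0 ≤ empMean z fun x => lossDiff m θ₁ θ₀ x ^ 2 :=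
      div_nonneg (Finset.sum_nonneg fun i _ => sq_nonneg _) hn0.le
    have hG₁ : |empG P z (lossDiff m θ₁ θ₀)| ≤ k * √v :=
      abs_le_of_sq_le_sq (by linarith) (by positivity)
    have hM₁ : (empMean z fun x => lossDiff m θ₁ θ₀ x ^ 2) / n ≤ (k * a) ^ 2 := by
      rw [div_le_iff₀ hn0]
      have : (k * a) ^ 2 * n = (k * √v) ^ 2 := by
        rw [← hsa]
        linear_combination -(k ^ 2 * a ^ 2) * hss
      linarith [sq_nonneg (empG P z (lossDiff m θ₁ θ₀))]
    have hM₂ : (empMean z fun x => lossDiff m θ θ₀ x ^ 2) / n ≤ (η * t) ^ 2 := by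
      rw [empMean, div_div, div_le_iff₀ (by positivity)]
      linarith
    have hmean := empMean_lossDiff_sub m z θ θ₁ θ₀
    rw [empMean_eq_add P hn z (lossDiff m θ θ₀), empMean_eq_add P hn z (lossDiff m θ₁ θ₀),
      integral_lossDiff hi, integral_lossDiff hi] at hmean
    have hdev : -(η * t) ≤ empG P z (lossDiff m θ θ₀) / √(n : ℝ) := by
      rw [le_div_iff₀ hs0]
      linarith [neg_le_of_abs_le hG]
    have hdev₁ : empG P z (lossDiff m θ₁ θ₀) / √(n : ℝ) ≤ k * a := by
      rw [div_le_iff₀ hs0]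
      have : k * a * √(n : ℝ) = k * √v := by
        rw [← hsa]
        ring
      linarith [le_of_abs_le hG₁]
    have hvar : √(2 * sampleVar z (lossDiff m θ θ₁) * L / n) ≤ l * (η * t + k * a) := by
      have hηt : 0 ≤ η * t := by positivity
      have hka : 0 ≤ k * a := by positivity
      refine Real.sqrt_le_iff.2 ⟨by positivity, ?_⟩
      rw [mul_pow, Real.sq_sqrt (by positivity)]
      have h1 := sampleVar_lossDiff_le m hn2 z θ θ₁ θ₀
      calc 2 * sampleVar z (lossDiff m θ θ₁) * L / n
          ≤ 2 * (4 * ((empMean z fun x => lossDiff m θ θ₀ x ^ 2) +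
            empMean z fun x => lossDiff m θ₁ θ₀ x ^ 2)) * L / n := by gcongr
        _ = 8 * L * ((empMean z fun x => lossDiff m θ θ₀ x ^ 2) / n +
            (empMean z fun x => lossDiff m θ₁ θ₀ x ^ 2) / n) := by ring
        _ ≤ 8 * L * (η * t + k * a) ^ 2 := by
          gcongr
          nlinarith
    -- `7 / (3 * (n - 1)) ≤ 5 / n` amounts to `15 ≤ 8 * n`, true from `n = 2` on.
    have hbern : 7 * B * L / (3 * ((n : ℝ) - 1)) ≤ 5 * L * (B / n) := by
      rw [mul_div_assoc', div_le_div_iff₀ (by linarith) hn0]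
      have := mul_nonneg (mul_nonneg hB0 hL.le) (sub_nonneg.2 hn2')
      have : 0 ≤ B * L := by positivity
      linarith
    have hηt : (1 + l) * (η * t) = t / 4 := by
      rw [← mul_assoc, hη]
      ring
    have hmain : D ≤ t / 4 + C₁ + (1 + l) * k * a + 5 * L * (B / n) := by
      linarith
    exact le_mul_add_of_le hmain htM has hC₁ ha0 hlk hM hτ hL.le hτ0

end MEst

/-- The power `1 / p ≤ 1` is subadditive on nonnegative reals. -/
lemma le_mul_of_mul_rpow_le {c d p C x y s : ℝ} (hc : 0 < c) (hd : 0 ≤ d) (hp : 1 ≤ p)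
    (hC : 0 ≤ C) (hx : 0 ≤ x) (hy : 0 ≤ y) (hs : 0 ≤ s) (h : c * d ^ p ≤ C * (x + y + s)) :
    d ≤ C ^ (1 / p) * c ^ (-(1 / p)) * (x ^ (1 / p) + y ^ (1 / p) + s ^ (1 / p)) := by
  have hp0 : 0 < p := by linarith
  have hq0 : 0 ≤ 1 / p := by positivity
  have hq1 : 1 / p ≤ 1 := (div_le_one hp0).2 hp
  have h1 : d ≤ (C * (x + y + s) / c) ^ (1 / p) := by
    rw [one_div, Real.le_rpow_inv_iff_of_pos hd (by positivity) hp0, le_div_iff₀ hc]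
    linarith
  refine h1.trans ?_
  rw [Real.div_rpow (by positivity) hc.le, Real.mul_rpow hC (by positivity), Real.rpow_neg hc.le,
    div_eq_mul_inv, mul_right_comm]
  gcongr
  refine (Real.rpow_add_le_add_rpow (by positivity) hs hq0 hq1).trans ?_
  gcongr
  exact Real.rpow_add_le_add_rpow hx hy hq0 hq1

theorem mainTheorem4
    (α₁ β q B₀ ε : ℝ) (hα₁ : 0 < α₁ ∧ α₁ < 1) (hβ : 0 ≤ β) (hq : q < 1 + β) (hε : 0 < ε) :
    -- the constant depends on `α₁, β, q, B₀, ε` only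
    ∃ C : ℝ, 0 < C ∧
      ∀ {Θ : Type*} {𝒵 : Type*} {𝒟 : Type*} {Ω : Type*}
        [PseudoMetricSpace Θ] [MeasurableSpace 𝒵] [MeasurableSpace 𝒟] [MeasurableSpace Ω]
        (P : Measure 𝒵) [IsProbabilityMeasure P]
        (μ : Measure Ω) [IsProbabilityMeasure μ]
        -- the loss function
        (m : Θ → 𝒵 → ℝ) (_ : ∀ θ, Measurable (m θ)) (_ : ∀ θ, Integrable (m θ) P)
        (_ : ∀ θ₁ θ₂ : Θ, ∀ z : 𝒵, |m θ₁ z - m θ₂ z| ≤ B₀)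
        -- the sample `D₂ = (Z₁, …, Z_n)`, independent and identically distributed from `P`
        (n : ℕ) (_ : 1 ≤ n) (Z : Fin n → Ω → 𝒵) (_ : ∀ i, Measurable (Z i))
        (_ : ∀ i, μ.map (Z i) = P) (_ : iIndepFun Z μ)
        -- the sample `D₁`, independent of `D₂`, and the initial estimator computed from it
        (D₁ : Ω → 𝒟) (_ : Measurable D₁) (_ : IndepFun D₁ (fun ω i => Z i ω) μ)
        (θhat : 𝒟 → Θ) (_ : Measurable fun p : 𝒟 × 𝒵 => m (θhat p.1) p.2)
        -- the upper confidence bound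
        (U : Θ → Θ → (Fin n → 𝒵) → ℝ)
        -- the target, with the curvature condition
        (θP : Θ) (_ : MEst.IsUniqueMinimizer m P θP)
        (c₀ : ℝ) (_ : 0 < c₀) (_ : MEst.MarginCondition m P θP c₀ β)
        -- the local modulus
        (φ : ℝ → ℝ) (_ : MEst.LocalModulus m P θP n q φ) (_ : MEst.SquaresMeasurable m P θP n)
        -- the quality of the initial estimator
        (s : Ω → ℝ) (_ : ∀ᵐ ω ∂μ, MEst.initialError m P θP n (θhat (D₁ ω)) ≤ s ω)
        -- the rate
        (r : ℝ) (_ : 0 < r)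
        (_ : (r ^ 2)⁻¹ * φ (c₀ ^ (-(1 / (1 + β))) * r ^ (2 / (1 + β))) ≤ √(n : ℝ)),
        ∃ A : Set Ω, MeasurableSet A ∧ ENNReal.ofReal (1 - ε) ≤ μ A ∧ ∀ ω ∈ A,
          Metric.ediam (MEst.ebSet m B₀ α₁ U (θhat (D₁ ω)) (fun i => Z i ω)) ≤
            ENNReal.ofReal (C * c₀ ^ (-(1 / (1 + β))) *
              (r ^ (2 / (1 + β)) + (B₀ / n) ^ (1 / (1 + β)) + s ω ^ (1 / (1 + β)))) := by
  obtain ⟨hα0, hα1⟩ := hα₁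
  have hb : 0 < 1 + β := by linarith
  have hκ : 0 < 1 - q / (1 + β) := by
    have : q / (1 + β) < 1 := (div_lt_one hb).2 hq
    linarith
  have hL : 0 < Real.log (2 / α₁) := Real.log_pos ((one_lt_div hα0).2 (by linarith))
  set l := √(8 * Real.log (2 / α₁)) with hl
  have hl0 : 0 ≤ l := Real.sqrt_nonneg _
  -- The fluctuation enters with weight 1 and the standard deviation with weight `l`; this η makes
  -- their total `t / 4`.
  obtain ⟨η, hηdef⟩ : ∃ η : ℝ, η = 1 / (4 * (1 + l)) := ⟨_, rfl⟩
  have hη0 : 0 < η := by rw [hηdef]; positivity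
  have hη : (1 + l) * η = 1 / 4 := by rw [hηdef]; field_simp
  have hη1 : η ≤ 1 := by nlinarith
  obtain ⟨M, hM1, hM⟩ := exists_tsum_ofReal_rpow_le (K := 54 / η ^ 2) hκ (by positivity)
    (half_pos hε)
  set C' := M / 2 + 2 * (1 + (1 + l) * √(2 * (ε / 2)⁻¹)) + 10 * Real.log (2 / α₁) with hC'
  have hC'0 : 0 < C' := by positivity
  have hM0 : 0 ≤ M := by linarith
  have hK0 : 0 < (ε / 2)⁻¹ := by positivity
  -- The factor 2 is the triangle inequality through `θP`.
  refine ⟨2 * C' ^ (1 / (1 + β)), by positivity, ?_⟩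
  intro Θ 𝒵 𝒟 Ω _ _ _ _ P _ μ _ m hm hi hB n hn Z hZ hZP hZind D₁ hD₁ hind θhat hθhat U θP _
    c₀ hc hmar φ hφ hsq s hs r hr hrate
  obtain ⟨V, hVm, hVle, hV⟩ := MEst.exists_event_empirical hm hB hn hφ hsq hβ hq hc hr hrate hη0
    hη1 hM1 hM
  have := Measure.isProbabilityMeasure_map (μ := μ) hD₁.aemeasurable
  obtain ⟨W, hWm, hWle, hW⟩ := MEst.exists_event_initial (P := P) (ν := μ.map D₁) hm hB hn hθhat θP
    (K := (ε / 2)⁻¹) (by positivity)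
  rw [inv_inv] at hWle
  have hZm : Measurable fun ω i => Z i ω := measurable_pi_lambda _ hZ
  have hZlaw : μ.map (fun ω i => Z i ω) = Measure.pi fun _ => P := by
    rw [(iIndepFun_iff_map_fun_eq_pi_map fun i => (hZ i).aemeasurable).1 hZind]
    simp_rw [hZP]
  have hjoint : μ.map (fun ω => (D₁ ω, fun i => Z i ω)) =
      (μ.map D₁).prod (Measure.pi fun _ : Fin n => P) := by
    rw [(indepFun_iff_map_prod_eq_prod_map_map hD₁.aemeasurable hZm.aemeasurable).1 hind, hZlaw]
  set N := toMeasurable μ {ω | ¬ MEst.initialError m P θP n (θhat (D₁ ω)) ≤ s ω}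
  have hN : μ N = 0 := by
    rw [measure_toMeasurable]
    exact hs
  set E := N ∪ ((fun ω i => Z i ω) ⁻¹' V ∪ (fun ω => (D₁ ω, fun i => Z i ω)) ⁻¹' W) with hE
  have hEm : MeasurableSet E := (measurableSet_toMeasurable _ _).union
    ((hZm hVm).union ((hD₁.prodMk hZm) hWm))
  have hEle : μ E ≤ ENNReal.ofReal ε := by
    refine (measure_union_le _ _).trans ?_
    rw [hN, zero_add]
    refine (measure_union_le _ _).trans ?_
    rw [← Measure.map_apply hZm hVm, ← Measure.map_apply (hD₁.prodMk hZm) hWm, hZlaw, hjoint]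
    refine (add_le_add hVle hWle).trans (le_of_eq ?_)
    rw [← ENNReal.ofReal_add (by positivity) (by positivity), add_halves]
  refine ⟨Eᶜ, hEm.compl, ?_, ?_⟩
  · rw [prob_compl_eq_one_sub hEm, ENNReal.ofReal_sub _ hε.le, ENNReal.ofReal_one]
    exact tsub_le_tsub_left hEle 1
  · intro ω hω
    simp only [hE, Set.mem_compl_iff, Set.mem_union, not_or, Set.mem_preimage] at hω
    obtain ⟨hωN, hωV, hωW⟩ := hω
    have hωs : MEst.initialError m P θP n (θhat (D₁ ω)) ≤ s ω := by
      by_contra hcon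
      exact hωN (subset_toMeasurable _ _ hcon)
    have hWω := hW (D₁ ω, fun i => Z i ω) hωW
    have hs0 : 0 ≤ s ω := by
      refine le_trans (add_nonneg (by positivity) ?_) hωs
      exact le_trans (by positivity) (hmar (θhat (D₁ ω)))
    obtain ⟨x₀⟩ : Nonempty 𝒵 := nonempty_of_isProbabilityMeasure P
    have hB0 : 0 ≤ B₀ := (abs_nonneg _).trans (hB θP θP x₀)
    set R := r ^ (2 / (1 + β)) + (B₀ / n) ^ (1 / (1 + β)) + s ω ^ (1 / (1 + β))
    have hdist : ∀ θ ∈ MEst.ebSet m B₀ α₁ U (θhat (D₁ ω)) (fun i => Z i ω),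
        dist θ θP ≤ C' ^ (1 / (1 + β)) * c₀ ^ (-(1 / (1 + β))) * R := by
      intro θ hθ
      obtain ⟨t, ht0, htM, hG, hS⟩ := hV _ hωV θ
      have hr2 : r ^ (2 / (1 + β)) = (r ^ 2) ^ (1 / (1 + β)) := by
        rw [← Real.rpow_natCast r 2, ← Real.rpow_mul hr.le]
        norm_num [div_eq_mul_inv]
      have hτ : B₀ / n ≤ r ^ 2 + B₀ / n := le_add_of_nonneg_left (sq_nonneg r)
      have hmul := MEst.mul_dist_rpow_le_of_mem_ebSet hi hB hn hc hmar hθ hL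
        hK0 hM0 hη hη0.le ht0 htM hτ hG hS hWω hωs
      simp only [R, hr2]
      exact le_mul_of_mul_rpow_le hc dist_nonneg (by linarith) hC'0.le (by positivity)
        (by positivity) hs0 hmul
    refine Metric.ediam_le fun x hx y hy => ?_
    rw [edist_dist]
    refine ENNReal.ofReal_le_ofReal ((dist_triangle_right x y θP).trans ?_)
    calc dist x θP + dist y θP ≤ _ := add_le_add (hdist x hx) (hdist y hy)
      _ = 2 * C' ^ (1 / (1 + β)) * c₀ ^ (-(1 / (1 + β))) * R := by ring
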